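/- Let $0<\rho<1$, let $\alpha,h\in\mathbb R$, and put $\eta=(1+\rho^2)\xi$, $z=-\rho^2\xi^2$ and $$\Delta_k^{\pm}=2k\pm\sqrt{\frac{h}{4(1+\rho^2)}}\qquad(k=0,1,2,\dots),$$ with an imaginary square root if $h<0$. Assume that $h\neq 4(1+\rho^2)m^2$ for every integer $m\ge 2$ (so that no denominator below vanishes). Let $(x)_i=x(x+1)\cdots(x+i-1)$ and consider $$ \begin{aligned} LF^R(\xi)=\;&\sum_{i_0=0}^{\infty}\frac{(\Delta_0^-)_{i_0}(\Delta_0^+)_{i_0}}{(1)_{i_0}(\frac12)_{i_0}}\eta^{i_0} +\sum_{n=1}^{\infty}\Bigg\{\sum_{i_0=0}^{\infty}\frac{(i_0+\frac{\alpha}{2}+\frac12)(i_0-\frac{\alpha}{2})}{(i_0+2)(i_0+\frac32)}\frac{(\Delta_0^-)_{i_0}(\Delta_0^+)_{i_0}}{(1)_{i_0}(\frac12)_{i_0}}\\ &\times\prod_{k=1}^{n-1}\Bigg\{\sum_{i_k=i_{k-1}}^{\infty}\frac{(i_k+2k+\frac{\alpha}{2}+\frac12)(i_k+2k-\frac{\alpha}{2})}{(i_k+2k+2)(i_k+2k+\frac32)}\frac{(\Delta_k^-)_{i_k}(\Delta_k^+)_{i_k}(2k+1)_{i_{k-1}}(2k+\frac12)_{i_{k-1}}}{(\Delta_k^-)_{i_{k-1}}(\Delta_k^+)_{i_{k-1}}(2k+1)_{i_k}(2k+\frac12)_{i_k}}\Bigg\}\\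 &\times\sum_{i_n=i_{n-1}}^{\infty}\frac{(\Delta_n^-)_{i_n}(\Delta_n^+)_{i_n}(2n+1)_{i_{n-1}}(2n+\frac12)_{i_{n-1}}}{(\Delta_n^-)_{i_{n-1}}(\Delta_n^+)_{i_{n-1}}(2n+1)_{i_n}(2n+\frac12)_{i_n}}\eta^{i_n}\Bigg\}z^n , \end{aligned} $$ where the products denote nested sums (each sum stands inside the preceding ones). Let $D=\{\xi\in\mathbb C:|\eta|+|z|<1\}$, a disc about $0$. Then: 1. For $\xi\in D$ all the nested series, and the series over $n$, converge absolutely. 2. $LF^R$ is the first (exponent $0$, normalized) local solution at $\xi=0$ of Lamé's equation $$\frac{d^2y}{d\xi^2}+\frac12\Big(\frac1\xi+\frac1{\xi-1}+\frac1{\xi-\rho^{-2}}\Big)\frac{dy}{d\xi}+\frac{-\alpha(\alpha+1)\xi+h\rho^{-2}}{4\xi(\xi-1)(\xi-\rho^{-2})}\,y=0 :$$ it is analytic on $D$, $LF^R(0)=1$, it satisfies the equation on $D\setminus\{0\}$, and every function that is analytic at $0$, takes the value $1$ there and satisfies the equation in a punctured neighbourhood of $0$ coincides with $LF^R$ near $0$.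 3. Let $K=\int_0^1\frac{dt}{\sqrt{(1-t^2)(1-\rho^2t^2)}}$. For real $u\in(-K,K)$ with $\mathrm{sn}^2(u,\rho)\in D$, the function $Y(u)=LF^R(\mathrm{sn}^2(u,\rho))$ is twice continuously differentiable near $u$ and satisfies Lamé's equation in Weierstrass's form, $Y''(u)=\{\alpha(\alpha+1)\rho^2\,\mathrm{sn}^2(u,\rho)-h\}\,Y(u)$. 4. If moreover $\alpha\notin\{2m,\,-(2m+1)\}$ for every integer $m\ge1$, then for $\xi\in D$ the series $LF^R(\xi)$ equals the three-term-recurrence (3TRF) series, in which the roles of the two terms of the recurrence are interchanged: $$ \begin{aligned} LF(\xi)=\;&\sum_{i_0=0}^{\infty}\frac{(-\frac\alpha4)_{i_0}(\frac\alpha4+\frac14)_{i_0}}{(1)_{i_0}(\frac34)_{i_0}}z^{i_0} +\sum_{n=1}^{\infty}\Bigg\{\sum_{i_0=0}^{\infty}\frac{i_0^2-\frac{h}{16(1+\rho^2)}}{(i_0+\frac12)(i_0+\frac14)}\frac{(-\frac\alpha4)_{i_0}(\frac\alpha4+\frac14)_{i_0}}{(1)_{i_0}(\frac34)_{i_0}}\\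 &\times\prod_{k=1}^{n-1}\Bigg\{\sum_{i_k=i_{k-1}}^{\infty}\frac{(i_k+\frac k2)^2-\frac{h}{16(1+\rho^2)}}{(i_k+\frac k2+\frac12)(i_k+\frac k2+\frac14)}\frac{(\frac k2-\frac\alpha4)_{i_k}(\frac k2+\frac\alpha4+\frac14)_{i_k}(\frac k2+1)_{i_{k-1}}(\frac k2+\frac34)_{i_{k-1}}}{(\frac k2-\frac\alpha4)_{i_{k-1}}(\frac k2+\frac\alpha4+\frac14)_{i_{k-1}}(\frac k2+1)_{i_k}(\frac k2+\frac34)_{i_k}}\Bigg\}\\ &\times\sum_{i_n=i_{n-1}}^{\infty}\frac{(\frac n2-\frac\alpha4)_{i_n}(\frac n2+\frac\alpha4+\frac14)_{i_n}(\frac n2+1)_{i_{n-1}}(\frac n2+\frac34)_{i_{n-1}}}{(\frac n2-\frac\alpha4)_{i_{n-1}}(\frac n2+\frac\alpha4+\frac14)_{i_{n-1}}(\frac n2+1)_{i_n}(\frac n2+\frac34)_{i_n}}z^{i_n}\Bigg\}\eta^n , \end{aligned} $$ all of whose series converge absolutely as well. -/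

import Mathlib

noncomputable section

namespace Lame

/-- The Pochhammer symbol `(x)_n = x (x+1) ⋯ (x+n-1)`. -/
def poch (x : ℂ) (n : ℕ) : ℂ := (ascPochhammer ℂ n).eval x

/-- For weights `w k p i`, factors `b k i` and a variable `t`, the summand with index `i = i_k`
of the nested series (with `p = i_{k-1}` and `m` further sums nested inside)
`∑_{i_k ≥ p} b k i_k * w k p i_k * ∑_{i_{k+1} ≥ i_k} b (k+1) i_{k+1} * w (k+1) i_k i_{k+1} * ⋯
  * ∑_{i_{k+m} ≥ i_{k+m-1}} w (k+m) i_{k+m-1} i_{k+m} * t ^ i_{k+m}`.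
The innermost sum has no factor `b` and carries the power of `t`. -/
def nestedSummand (w : ℕ → ℕ → ℕ → ℂ) (b : ℕ → ℕ → ℂ) (t : ℂ) : ℕ → ℕ → ℕ → ℕ → ℂ
  | 0, k, p, i => w k p i * t ^ i
  | m + 1, k, p, i => b k i * w k p i * ∑' j : ℕ, nestedSummand w b t m (k + 1) i (i + j)

/-- The nested series itself, summed over `i_k = p + j`, `j = 0, 1, 2, …`. -/
def nestedSum (w : ℕ → ℕ → ℕ → ℂ) (b : ℕ → ℕ → ℂ) (t : ℂ) (m k p : ℕ) : ℂ :=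
  ∑' j : ℕ, nestedSummand w b t m k p (p + j)

/-- All series occurring in `∑_n (nestedSum w b t n 0 0) * u ^ n` converge (in `ℂ`, summability is
absolute convergence): the nested ones at every level, and the outer series over `n`. -/
def NestedConverges (w : ℕ → ℕ → ℕ → ℂ) (b : ℕ → ℕ → ℂ) (t u : ℂ) : Prop :=
  (∀ m k p : ℕ, Summable fun j : ℕ => nestedSummand w b t m k p (p + j)) ∧
    Summable fun n : ℕ => nestedSum w b t n 0 0 * u ^ n

/-- `η = (1 + ρ²) ξ`. -/
def eta (ρ : ℝ) (ξ : ℂ) : ℂ := (1 + (ρ : ℂ) ^ 2) * ξ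

/-- `z = -ρ² ξ²`. -/
def zvar (ρ : ℝ) (ξ : ℂ) : ℂ := -(ρ : ℂ) ^ 2 * ξ ^ 2

/-- `√(h / (4 (1 + ρ²)))`, imaginary for `h < 0`. -/
def root (ρ h : ℝ) : ℂ := ((h / (4 * (1 + ρ ^ 2)) : ℝ) : ℂ) ^ (1 / 2 : ℂ)

def DeltaMinus (ρ h : ℝ) (k : ℕ) : ℂ := 2 * k - root ρ h

def DeltaPlus (ρ h : ℝ) (k : ℕ) : ℂ := 2 * k + root ρ h

/-- The Pochhammer quotient with index `i = i_k`, `p = i_{k-1}` of the R3TRF series. At `k = 0`,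
`p = 0` it is `(Δ₀⁻)_i (Δ₀⁺)_i / ((1)_i (1/2)_i)`. -/
def rWeight (ρ h : ℝ) (k p i : ℕ) : ℂ :=
  (poch (DeltaMinus ρ h k) i * poch (DeltaPlus ρ h k) i
      * poch (2 * k + 1) p * poch (2 * k + 1 / 2) p) /
    (poch (DeltaMinus ρ h k) p * poch (DeltaPlus ρ h k) p
      * poch (2 * k + 1) i * poch (2 * k + 1 / 2) i)

def rFactor (α : ℝ) (k i : ℕ) : ℂ :=
  ((i + 2 * k + α / 2 + 1 / 2) * (i + 2 * k - α / 2)) /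
    ((i + 2 * k + 2) * (i + 2 * k + 3 / 2))

/-- The R3TRF series of the first kind: a series in powers of `z` whose coefficients are nested
series in `η`. -/
def LFR (ρ α h : ℝ) (ξ : ℂ) : ℂ :=
  ∑' n : ℕ, nestedSum (rWeight ρ h) (rFactor α) (eta ρ ξ) n 0 0 * zvar ρ ξ ^ n

/-- The Pochhammer quotient of the 3TRF series. -/
def tWeight (α : ℝ) (k p i : ℕ) : ℂ :=
  (poch (k / 2 - α / 4) i * poch (k / 2 + α / 4 + 1 / 4) i
      * poch (k / 2 + 1) p * poch (k / 2 + 3 / 4) p) /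
    (poch (k / 2 - α / 4) p * poch (k / 2 + α / 4 + 1 / 4) p
      * poch (k / 2 + 1) i * poch (k / 2 + 3 / 4) i)

def tFactor (ρ h : ℝ) (k i : ℕ) : ℂ :=
  ((i + k / 2) ^ 2 - h / (16 * (1 + (ρ : ℂ) ^ 2))) /
    ((i + k / 2 + 1 / 2) * (i + k / 2 + 1 / 4))

/-- The 3TRF series of the first kind: a series in powers of `η` whose coefficients are nested
series in `z`. -/
def LF (ρ α h : ℝ) (ξ : ℂ) : ℂ :=
  ∑' n : ℕ, nestedSum (tWeight α) (tFactor ρ h) (zvar ρ ξ) n 0 0 * eta ρ ξ ^ n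

/-- The disc `|η| + |z| < 1` about `ξ = 0`. -/
def domain (ρ : ℝ) : Set ℂ := {ξ | ‖eta ρ ξ‖ + ‖zvar ρ ξ‖ < 1}

/-- Lamé's equation with independent variable `ξ = sn²(u, ρ)`, at the point `ξ`. -/
def LameEqAt (ρ α h : ℝ) (y : ℂ → ℂ) (ξ : ℂ) : Prop :=
  deriv (deriv y) ξ
    + 1 / 2 * (1 / ξ + 1 / (ξ - 1) + 1 / (ξ - ((ρ : ℂ) ^ 2)⁻¹)) * deriv y ξ
    + (-(α * (α + 1)) * ξ + h * ((ρ : ℂ) ^ 2)⁻¹) /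
        (4 * ξ * (ξ - 1) * (ξ - ((ρ : ℂ) ^ 2)⁻¹)) * y ξ = 0

/-- The incomplete elliptic integral of the first kind, in Jacobi's form. -/
def ellipticF (ρ x : ℝ) : ℝ := ∫ t in (0 : ℝ)..x, 1 / √((1 - t ^ 2) * (1 - ρ ^ 2 * t ^ 2))

/-- The interval `(-K, K)`, with `K` the complete elliptic integral. -/
def snDomain (ρ : ℝ) : Set ℝ := ellipticF ρ '' Set.Ioo (-1) 1

/-- Jacobi's `sn(u, ρ)` for `-K < u < K`: the inverse of the elliptic integral on `(-1, 1)`. -/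
def sn (ρ u : ℝ) : ℝ := Function.invFunOn (ellipticF ρ) (Set.Ioo (-1) 1) u

end Lame

end

/-!
In terms of `θ = ξ d/dξ`, Lamé's equation is of degree two in `ξ`, so the coefficients of a
solution that is analytic at `0` obey a three-term recurrence. Iterating the recurrence writes the
`n`-th term as a sum over all ways of reaching `n` by unit steps, each contributing a factor `η`,
and double steps, each contributing a factor `z`. A word of `l` unit and `m` double steps is a
lattice path from `(0, 0)` to `(m, l)`, and a path can be recorded by its runs of unit steps or by
its runs of double steps. The two nested series arise in this way from the same double series
in `η ^ l * z ^ m`, summed over one index first or over the other.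

The step weights tend to `1`. Hence, for every `q > 1`, the weight of a path is at most
`C * q ^ (l + m)` in absolute value. There are `(m + l).choose m` paths, so absolute convergence for
`|η| + |z| < 1` follows from that of `∑ (m + l).choose m * |η| ^ l * |z| ^ m`.

Finally, `s = sn u` satisfies `s' ^ 2 = (1 - s ^ 2) * (1 - ρ ^ 2 * s ^ 2)`, and the substitution
`ξ = s ^ 2` turns the equation in algebraic form into the one in Weierstrass's form.
-/

noncomputable section

namespace Lame

open Finset Filter Topology

/-! ### Lattice paths and nested series -/

section LatticePaths

variable {S : Type*} [CommSemiring S]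

/-- The sum over all lattice paths from `(0, 0)` to `(m, l)` of the products of their step weights,
where the step from `(k, i)` to `(k, i + 1)` has weight `f k i` and the step from `(k, i)` to
`(k + 1, i)` has weight `b k i`. -/
def pathSum (f b : ℕ → ℕ → S) : ℕ → ℕ → S
  | 0, 0 => 1
  | 0, l + 1 => f 0 l * pathSum f b 0 l
  | m + 1, 0 => b m 0 * pathSum f b m 0
  | m + 1, l + 1 => f (m + 1) l * pathSum f b (m + 1) l + b m (l + 1) * pathSum f b m (l + 1)

lemma pathSum_swap (f b : ℕ → ℕ → S) (m l : ℕ) :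
    pathSum (fun k i => b i k) (fun k i => f i k) l m = pathSum f b m l := by
  induction m generalizing l with
  | zero =>
    induction l with
    | zero => simp only [pathSum]
    | succ l ih => simp only [pathSum, ih]
  | succ m ihm =>
    induction l with
    | zero => simp only [pathSum, ihm]
    | succ l ihl => simp only [pathSum, ihm, ihl, add_comm]

lemma pathSum_const_mul (x y : S) (f b : ℕ → ℕ → S) (m l : ℕ) :
    pathSum (fun k i => x * f k i) (fun k i => y * b k i) m l =
      x ^ l * y ^ m * pathSum f b m l := by
  induction m generalizing l with
  | zero =>
    induction l with
    | zero => simp only [pathSum, pow_zero, mul_one]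
    | succ l ih => simp only [pathSum, ih]; ring
  | succ m ihm =>
    induction l with
    | zero => simp only [pathSum, ihm]; ring
    | succ l ihl => simp only [pathSum, ihm, ihl]; ring

/-- The coefficient of `t ^ (p + l)` in `nestedSum w b t m k p`. -/
def nestedCoeff (w : ℕ → ℕ → ℕ → S) (b : ℕ → ℕ → S) : ℕ → ℕ → ℕ → ℕ → S
  | 0, k, p, l => w k p (p + l)
  | m + 1, k, p, l => ∑ x ∈ antidiagonal l,
      b k (p + x.1) * w k p (p + x.1) * nestedCoeff w b m (k + 1) (p + x.1) x.2

/-- `w k p i` is the product of the step weights `f k p, …, f k (i - 1)`. The normalization at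
level `k = 0` is imposed only at `p = 0`, where the outermost sum of a nested series starts. -/
structure IsPathWeight (w : ℕ → ℕ → ℕ → S) (f : ℕ → ℕ → S) : Prop where
  succ : ∀ k p j, w k p (p + j + 1) = f k (p + j) * w k p (p + j)
  self : ∀ k p, w (k + 1) p p = 1
  zero : w 0 0 0 = 1

namespace IsPathWeight

variable {w : ℕ → ℕ → ℕ → S} {f : ℕ → ℕ → S}

lemma nestedCoeff_succ_zero (hw : IsPathWeight w f) (b : ℕ → ℕ → S) (m k p : ℕ) :
    nestedCoeff w b (m + 1) k p 0 = b (k + m) p * nestedCoeff w b m k p 0 := by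
  induction m generalizing k with
  | zero => simp [nestedCoeff, hw.self]
  | succ m ih =>
    have hstep := ih (k + 1)
    rw [nestedCoeff.eq_2 w b k p 0 (m + 1), nestedCoeff.eq_2 w b k p 0 m]
    simp only [Nat.antidiagonal_zero, sum_singleton, add_zero, hstep]
    rw [show k + 1 + m = k + (m + 1) by ring]
    ring

lemma nestedCoeff_succ_succ (hw : IsPathWeight w f) (b : ℕ → ℕ → S) (m k p l : ℕ) :
    nestedCoeff w b (m + 1) k p (l + 1) = f (k + m + 1) (p + l) * nestedCoeff w b (m + 1) k p l +
      b (k + m) (p + l + 1) * nestedCoeff w b m k p (l + 1) := by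
  induction m generalizing k p l with
  | zero =>
    simp only [nestedCoeff, Nat.sum_antidiagonal_succ', add_zero, hw.self, mul_one,
      ← add_assoc, hw.succ]
    rw [add_comm, Finset.mul_sum]
    refine congrArg₂ _ (Finset.sum_congr rfl fun x hx => ?_) rfl
    rw [show p + x.1 + x.2 = p + l by have := mem_antidiagonal.1 hx; omega]
    ring
  | succ m ih =>
    have hstep : ∀ x ∈ antidiagonal l, b k (p + x.1) * w k p (p + x.1) *
          nestedCoeff w b (m + 1) (k + 1) (p + x.1) (x.2 + 1) =
        f (k + (m + 1) + 1) (p + l) * (b k (p + x.1) * w k p (p + x.1) *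
          nestedCoeff w b (m + 1) (k + 1) (p + x.1) x.2) +
        b (k + (m + 1)) (p + l + 1) * (b k (p + x.1) * w k p (p + x.1) *
          nestedCoeff w b m (k + 1) (p + x.1) (x.2 + 1)) := fun x hx => by
      rw [ih, show p + x.1 + x.2 = p + l by have := mem_antidiagonal.1 hx; omega,
        show k + 1 + m = k + (m + 1) by ring]
      ring
    rw [nestedCoeff.eq_2 w b k p _ (m + 1), nestedCoeff.eq_2 w b k p _ (m + 1),
      nestedCoeff.eq_2 w b k p _ m, Nat.sum_antidiagonal_succ', Nat.sum_antidiagonal_succ',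
      sum_congr rfl hstep, sum_add_distrib, ← mul_sum, ← mul_sum, hw.nestedCoeff_succ_zero,
      show k + 1 + m = k + (m + 1) by ring, ← add_assoc p l 1]
    ring

/-- Both sides obey the recurrence that classifies a path by its last step. -/
theorem nestedCoeff_eq_pathSum (hw : IsPathWeight w f) (b : ℕ → ℕ → S) (m l : ℕ) :
    nestedCoeff w b m 0 0 l = pathSum f b m l := by
  induction m generalizing l with
  | zero =>
    induction l with
    | zero => simp only [pathSum, nestedCoeff, add_zero, hw.zero]
    | succ l ih =>
      simp only [pathSum, ← ih]
      simpa only [nestedCoeff, zero_add] using hw.succ 0 0 l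
  | succ m ihm =>
    induction l with
    | zero => rw [hw.nestedCoeff_succ_zero, ihm, pathSum, zero_add]
    | succ l ihl => simp only [hw.nestedCoeff_succ_succ, ihm, ihl, pathSum, zero_add]

end IsPathWeight

end LatticePaths

section PathMajorant

/-- A potential `Q` on the lattice, of geometric growth with ratio `r`, whose ratio along every
step is at least the norm of the step weight. -/
structure PathMajorant {A : Type*} [Norm A] (f b : ℕ → ℕ → A) (Q : ℕ → ℕ → ℝ) (r : ℝ) : Prop where
  pos : ∀ k i, 0 < Q k i
  right : ∀ k i, ‖f k i‖ * Q k i ≤ Q k (i + 1)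
  up : ∀ k i, ‖b k i‖ * Q k i ≤ Q (k + 1) i
  growth : ∃ C, ∀ k i, Q k i ≤ C * r ^ (k + i)

variable {A : Type*} [SeminormedCommRing A] {f b : ℕ → ℕ → A} {Q : ℕ → ℕ → ℝ} {r : ℝ}

lemma norm_mul_mul_le {x y : A} {q₀ q q' N : ℝ} (hx : ‖x‖ * q ≤ q') (hy : ‖y‖ * q₀ ≤ N * q)
    (hq₀ : 0 ≤ q₀) (hN : 0 ≤ N) : ‖x * y‖ * q₀ ≤ N * q' :=
  calc ‖x * y‖ * q₀ ≤ ‖x‖ * ‖y‖ * q₀ := by gcongr; exact norm_mul_le x y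
    _ = ‖x‖ * (‖y‖ * q₀) := mul_assoc _ _ _
    _ ≤ ‖x‖ * (N * q) := by gcongr
    _ = N * (‖x‖ * q) := mul_left_comm _ _ _
    _ ≤ N * q' := by gcongr

namespace PathMajorant

lemma ratio_pos (hQ : PathMajorant f b Q r) : 0 < r := by
  obtain ⟨C, hC⟩ := hQ.growth
  have hC₀ : 0 < C := by simpa using (hQ.pos 0 0).trans_le (hC 0 0)
  have hCr : 0 < C * r := by simpa using (hQ.pos 0 1).trans_le (hC 0 1)
  exact pos_of_mul_pos_right hCr hC₀.le

lemma norm_pathSum_le [NormOneClass A] (hQ : PathMajorant f b Q r) (m l : ℕ) :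
    ‖pathSum f b m l‖ * Q 0 0 ≤ (m + l).choose m * Q m l := by
  have hQ₀ := (hQ.pos 0 0).le
  induction m generalizing l with
  | zero =>
    induction l with
    | zero => simp [pathSum]
    | succ l ih =>
      simpa [pathSum] using norm_mul_mul_le (hQ.right 0 l) ih hQ₀ (Nat.cast_nonneg _)
  | succ m ihm =>
    induction l with
    | zero => simpa [pathSum] using norm_mul_mul_le (hQ.up m 0) (ihm 0) hQ₀ (Nat.cast_nonneg _)
    | succ l ihl =>
      have hright := norm_mul_mul_le (hQ.right (m + 1) l) ihl hQ₀ (Nat.cast_nonneg _)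
      have hup := norm_mul_mul_le (hQ.up m (l + 1)) (ihm (l + 1)) hQ₀ (Nat.cast_nonneg _)
      have hpascal : (m + 1 + (l + 1)).choose (m + 1) =
          (m + 1 + l).choose (m + 1) + (m + (l + 1)).choose m := by
        rw [← add_assoc, Nat.choose_succ_succ, add_comm, add_right_comm m 1 l, add_assoc m l 1]
      calc ‖pathSum f b (m + 1) (l + 1)‖ * Q 0 0
          ≤ (‖f (m + 1) l * pathSum f b (m + 1) l‖ + ‖b m (l + 1) * pathSum f b m (l + 1)‖) *
              Q 0 0 := by rw [pathSum]; gcongr; exact norm_add_le _ _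
        _ ≤ _ := by rw [hpascal, Nat.cast_add, add_mul, add_mul]; exact add_le_add hright hup

variable {w : ℕ → ℕ → ℕ → A}

lemma norm_weight_le (hQ : PathMajorant f b Q r) (hw : IsPathWeight w f) (k p j : ℕ) :
    ‖w k p (p + j)‖ * Q k p ≤ ‖w k p p‖ * Q k (p + j) := by
  induction j with
  | zero => rfl
  | succ j ih =>
    rw [← add_assoc, hw.succ]
    exact norm_mul_mul_le (hQ.right k _) ih (hQ.pos k p).le (norm_nonneg _)

lemma norm_mul_weight_mul_le (hQ : PathMajorant f b Q r) (hw : IsPathWeight w f) {k p j : ℕ}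
    {c : A} {B : ℝ} (hc : ‖c‖ * Q (k + 1) (p + j) ≤ B) :
    ‖b k (p + j) * w k p (p + j) * c‖ * Q k p ≤ ‖w k p p‖ * B := by
  have hstep := norm_mul_mul_le (hQ.up k (p + j)) (hQ.norm_weight_le hw k p j) (hQ.pos k p).le
    (norm_nonneg _)
  rw [mul_comm _ c]
  exact norm_mul_mul_le hc hstep (hQ.pos k p).le (norm_nonneg _)

lemma norm_nestedCoeff_le [NormOneClass A] (hQ : PathMajorant f b Q r) (hw : IsPathWeight w f)
    (m k p l : ℕ) :
    ‖nestedCoeff w b m k p l‖ * Q k p ≤ ‖w k p p‖ * ((m + l).choose m * Q (k + m) (p + l)) := by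
  induction m generalizing k p l with
  | zero => simpa [nestedCoeff] using hQ.norm_weight_le hw k p l
  | succ m ih =>
    have hterm : ∀ x ∈ antidiagonal l,
        ‖b k (p + x.1) * w k p (p + x.1) * nestedCoeff w b m (k + 1) (p + x.1) x.2‖ * Q k p ≤
          ‖w k p p‖ * ((m + x.2).choose m * Q (k + (m + 1)) (p + l)) := fun x hx => by
      refine hQ.norm_mul_weight_mul_le hw ?_
      have := ih (k + 1) (p + x.1) x.2
      rwa [hw.self, norm_one, one_mul, add_assoc p, mem_antidiagonal.1 hx, add_assoc k,
        add_comm 1 m] at this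
    calc ‖nestedCoeff w b (m + 1) k p l‖ * Q k p
        ≤ (∑ x ∈ antidiagonal l, ‖b k (p + x.1) * w k p (p + x.1) *
            nestedCoeff w b m (k + 1) (p + x.1) x.2‖) * Q k p :=
          mul_le_mul_of_nonneg_right (norm_sum_le _ _) (hQ.pos k p).le
      _ ≤ ∑ x ∈ antidiagonal l, ‖w k p p‖ * ((m + x.2).choose m * Q (k + (m + 1)) (p + l)) := by
          rw [sum_mul]; exact sum_le_sum hterm
      _ = ‖w k p p‖ * ((m + 1 + l).choose (m + 1) * Q (k + (m + 1)) (p + l)) := by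
          rw [← mul_sum, ← sum_mul, ← Nat.cast_sum, sum_antidiagonal_choose_add, add_right_comm]

end PathMajorant

end PathMajorant

section Summation

lemma hasSum_sum_antidiagonal {E : Type*} [AddCommMonoid E] [TopologicalSpace E]
    [RegularSpace E] [ContinuousAdd E] {g : ℕ × ℕ → E} {a : E} (hg : HasSum g a) :
    HasSum (fun n => ∑ x ∈ antidiagonal n, g x) a := by
  have hsigma := ((HasAntidiagonal.sigmaAntidiagonalEquivProd (A := ℕ)).hasSum_iff.2 hg).sigma
    fun n => hasSum_fintype _
  convert! hsigma using 2 with n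
  exact (sum_coe_sort (antidiagonal n) g).symm

lemma summable_choose_mul_pow_mul_pow {x y : ℝ} (hx : 0 ≤ x) (hy : 0 ≤ y) (hxy : x + y < 1) :
    Summable fun n : ℕ × ℕ => ((n.1 + n.2).choose n.1 : ℝ) * x ^ n.2 * y ^ n.1 := by
  have hx1 : ‖x‖ < 1 := by rw [Real.norm_of_nonneg hx]; linarith
  rw [summable_prod_of_nonneg fun n => by positivity]
  refine ⟨fun m => ?_, ?_⟩
  · simp only [add_comm m]
    exact (summable_choose_mul_geometric_of_norm_lt_one m hx1).mul_right (y ^ m)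
  · have hy1 : y / (1 - x) < 1 := (div_lt_one (by linarith)).2 (by linarith)
    refine ((summable_geometric_of_lt_one (div_nonneg hy (by linarith)) hy1).mul_left
      (1 / (1 - x))).congr fun m => ?_
    simp only [add_comm m]
    rw [tsum_mul_right, tsum_choose_mul_geometric_of_norm_lt_one m hx1, div_pow,
      div_mul_div_comm, ← pow_succ', one_mul, div_mul_eq_mul_div, one_mul]

namespace PathMajorant

variable {f b : ℕ → ℕ → ℂ} {w : ℕ → ℕ → ℕ → ℂ} {Q : ℕ → ℕ → ℝ} {r : ℝ} {t u : ℂ}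

theorem summable_pathSum (hQ : PathMajorant f b Q r) (htu : r * (‖t‖ + ‖u‖) < 1) :
    Summable fun x : ℕ × ℕ => pathSum f b x.1 x.2 * t ^ x.2 * u ^ x.1 := by
  obtain ⟨C, hC⟩ := hQ.growth
  have hr := hQ.ratio_pos
  have hbinom := summable_choose_mul_pow_mul_pow (x := r * ‖t‖) (y := r * ‖u‖)
    (by positivity) (by positivity) (by linarith)
  refine Summable.of_norm_bounded (hbinom.mul_left (C / Q 0 0)) fun ⟨m, l⟩ => ?_
  have hcoeff : ‖pathSum f b m l‖ ≤ (m + l).choose m * (C * r ^ (m + l)) / Q 0 0 := by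
    rw [le_div_iff₀ (hQ.pos 0 0)]
    refine (hQ.norm_pathSum_le m l).trans ?_
    gcongr
    exact hC m l
  rw [norm_mul, norm_mul, norm_pow, norm_pow]
  calc ‖pathSum f b m l‖ * ‖t‖ ^ l * ‖u‖ ^ m
      ≤ (m + l).choose m * (C * r ^ (m + l)) / Q 0 0 * ‖t‖ ^ l * ‖u‖ ^ m := by gcongr
    _ = C / Q 0 0 * ((m + l).choose m * (r * ‖t‖) ^ l * (r * ‖u‖) ^ m) := by ring

lemma summable_weight_mul_pow (hQ : PathMajorant f b Q r) (hw : IsPathWeight w f)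
    (ht : r * ‖t‖ < 1) (k p : ℕ) : Summable fun j => w k p (p + j) * t ^ (p + j) := by
  obtain ⟨C, hC⟩ := hQ.growth
  have hr := hQ.ratio_pos
  refine Summable.of_norm_bounded (((summable_geometric_of_lt_one (by positivity) ht).mul_left
    (‖w k p p‖ * (C * r ^ (k + p)) * ‖t‖ ^ p)).div_const (Q k p)) fun j => ?_
  rw [le_div_iff₀ (hQ.pos k p), norm_mul, norm_pow]
  calc ‖w k p (p + j)‖ * ‖t‖ ^ (p + j) * Q k p
      = ‖w k p (p + j)‖ * Q k p * ‖t‖ ^ (p + j) := by ring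
    _ ≤ ‖w k p p‖ * Q k (p + j) * ‖t‖ ^ (p + j) := by
      gcongr ?_ * _
      exact hQ.norm_weight_le hw k p j
    _ ≤ ‖w k p p‖ * (C * r ^ (k + (p + j))) * ‖t‖ ^ (p + j) := by gcongr; exact hC _ _
    _ = ‖w k p p‖ * (C * r ^ (k + p)) * ‖t‖ ^ p * (r * ‖t‖) ^ j := by ring

lemma summable_mul_nestedCoeff_mul_pow (hQ : PathMajorant f b Q r) (hw : IsPathWeight w f)
    (ht : r * ‖t‖ < 1) (m k p : ℕ) :
    Summable fun x : ℕ × ℕ => b k (p + x.1) * w k p (p + x.1) *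
      (nestedCoeff w b m (k + 1) (p + x.1) x.2 * t ^ (p + x.1 + x.2)) := by
  obtain ⟨C, hC⟩ := hQ.growth
  have hr := hQ.ratio_pos
  have hrt : 0 ≤ r * ‖t‖ := by positivity
  have hchoose := summable_choose_mul_geometric_of_norm_lt_one m
    (by rwa [Real.norm_of_nonneg hrt] : ‖r * ‖t‖‖ < 1)
  have hprod := (summable_geometric_of_lt_one hrt ht).mul_of_nonneg hchoose
    (fun j => by positivity) (fun l => by positivity)
  refine Summable.of_norm_bounded ((hprod.mul_left
    (‖w k p p‖ * (C * r ^ (k + 1 + m + p)) * ‖t‖ ^ p)).div_const (Q k p)) fun ⟨j, l⟩ => ?_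
  have hcoeff := hQ.norm_nestedCoeff_le hw m (k + 1) (p + j) l
  rw [hw.self, norm_one, one_mul] at hcoeff
  rw [le_div_iff₀ (hQ.pos k p), ← mul_assoc, norm_mul, norm_pow, add_comm l m]
  calc ‖b k (p + j) * w k p (p + j) * nestedCoeff w b m (k + 1) (p + j) l‖ *
        ‖t‖ ^ (p + j + l) * Q k p
      = ‖b k (p + j) * w k p (p + j) * nestedCoeff w b m (k + 1) (p + j) l‖ * Q k p *
        ‖t‖ ^ (p + j + l) := by ring
    _ ≤ ‖w k p p‖ * ((m + l).choose m * Q (k + 1 + m) (p + j + l)) * ‖t‖ ^ (p + j + l) := by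
        gcongr ?_ * _; exact hQ.norm_mul_weight_mul_le hw hcoeff
    _ ≤ ‖w k p p‖ * ((m + l).choose m * (C * r ^ (k + 1 + m + (p + j + l)))) *
        ‖t‖ ^ (p + j + l) := by gcongr; exact hC _ _
    _ = ‖w k p p‖ * (C * r ^ (k + 1 + m + p)) * ‖t‖ ^ p *
        ((r * ‖t‖) ^ j * ((m + l).choose m * (r * ‖t‖) ^ l)) := by ring

theorem hasSum_nestedSum (hQ : PathMajorant f b Q r) (hw : IsPathWeight w f)
    (ht : r * ‖t‖ < 1) (m k p : ℕ) :
    Summable (fun j => nestedSummand w b t m k p (p + j)) ∧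
      HasSum (fun l => nestedCoeff w b m k p l * t ^ (p + l)) (nestedSum w b t m k p) := by
  induction m generalizing k p with
  | zero =>
    have hsum := hQ.summable_weight_mul_pow hw ht k p
    exact ⟨hsum, hsum.hasSum⟩
  | succ m ih =>
    have hdouble := (hQ.summable_mul_nestedCoeff_mul_pow hw ht m k p).hasSum
    have houter : HasSum (fun j => nestedSummand w b t (m + 1) k p (p + j)) _ :=
      hdouble.prod_fiberwise fun j => (ih (k + 1) (p + j)).2.mul_left (b k (p + j) * w k p (p + j))
    refine ⟨houter.summable, ?_⟩
    rw [nestedSum, houter.tsum_eq]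
    convert! hasSum_sum_antidiagonal hdouble using 2 with l
    rw [nestedCoeff, sum_mul]
    refine sum_congr rfl fun x hx => ?_
    rw [add_assoc p, mem_antidiagonal.1 hx, mul_assoc]

theorem nestedConverges_and_hasSum (hQ : PathMajorant f b Q r) (hw : IsPathWeight w f)
    (htu : r * (‖t‖ + ‖u‖) < 1) :
    NestedConverges w b t u ∧ HasSum (fun m => nestedSum w b t m 0 0 * u ^ m)
      (∑' x : ℕ × ℕ, pathSum f b x.1 x.2 * t ^ x.2 * u ^ x.1) := by
  have hr := hQ.ratio_pos
  have hnested := hQ.hasSum_nestedSum hw (t := t)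
    (by linarith [mul_nonneg hr.le (norm_nonneg u)])
  have houter := (hQ.summable_pathSum htu).hasSum.prod_fiberwise fun m => by
    simpa only [hw.nestedCoeff_eq_pathSum, zero_add] using (hnested m 0 0).2.mul_right (u ^ m)
  exact ⟨⟨fun m k p => (hnested m k p).1, houter.summable⟩, houter⟩

end PathMajorant

end Summation

section Steps

section Semiring

variable {S : Type*} [CommSemiring S]

/-- The sum, over all words of `l` unit steps and `m` double steps along `ℕ` starting at `0`, of the
products of the step weights: a step from `n` to `n + 1` has weight `A n` and a step from `n` to
`n + 2` has weight `B n`. -/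
def stepSum (A B : ℕ → S) (m l : ℕ) : S :=
  pathSum (fun k i => A (i + 2 * k)) (fun k i => B (i + 2 * k)) m l

lemma stepSum_swap (A B : ℕ → S) (m l : ℕ) :
    pathSum (fun k i => B (k + 2 * i)) (fun k i => A (k + 2 * i)) l m = stepSum A B m l :=
  pathSum_swap (fun k i => A (i + 2 * k)) (fun k i => B (i + 2 * k)) m l

lemma stepSum_const_mul (x y : S) (A B : ℕ → S) (m l : ℕ) :
    stepSum (fun n => x * A n) (fun n => y * B n) m l = x ^ l * y ^ m * stepSum A B m l :=
  pathSum_const_mul x y _ _ m l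

/-- The solution of the three-term recurrence `c (n + 2) = A (n + 1) * c (n + 1) + B n * c n`,
`c 1 = A 0 * c 0`, with `c 0 = 1`. -/
def threeTermSeq (A B : ℕ → S) : ℕ → S
  | 0 => 1
  | 1 => A 0
  | n + 2 => A (n + 1) * threeTermSeq A B (n + 1) + B n * threeTermSeq A B n

open Polynomial in
/-- The solution of the three-term recurrence with a formal variable marking the double steps. -/
def threeTermPoly (A B : ℕ → S) : ℕ → S[X] :=
  threeTermSeq (fun n => C (A n)) fun n => C (B n) * X

lemma eval_one_threeTermPoly (A B : ℕ → S) (n : ℕ) :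
    (threeTermPoly A B n).eval 1 = threeTermSeq A B n := by
  induction n using Nat.twoStepInduction with
  | zero => simp [threeTermPoly, threeTermSeq]
  | one => simp [threeTermPoly, threeTermSeq]
  | more n ih ih' =>
    simp only [threeTermPoly] at ih ih'
    simp [threeTermPoly, threeTermSeq, ih, ih']

lemma coeff_threeTermPoly_of_lt (A B : ℕ → S) {m n : ℕ} (hn : n < 2 * m) :
    (threeTermPoly A B n).coeff m = 0 := by
  induction n using Nat.twoStepInduction generalizing m with
  | zero => simp [threeTermPoly, threeTermSeq, Polynomial.coeff_one, show m ≠ 0 by omega]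
  | one => simp [threeTermPoly, threeTermSeq, Polynomial.coeff_C, show m ≠ 0 by omega]
  | more n ih ih' =>
    obtain ⟨m, rfl⟩ : ∃ k, m = k + 1 := ⟨m - 1, by omega⟩
    simp only [threeTermPoly] at ih ih'
    simp [threeTermPoly, threeTermSeq, mul_assoc, ih (m := m) (by omega),
      ih' (m := m + 1) (by omega)]

lemma coeff_threeTermPoly (A B : ℕ → S) (m l : ℕ) :
    (threeTermPoly A B (l + 2 * m)).coeff m = stepSum A B m l := by
  have hrec (n m : ℕ) : (threeTermPoly A B (n + 2)).coeff (m + 1) =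
      A (n + 1) * (threeTermPoly A B (n + 1)).coeff (m + 1) +
        B n * (threeTermPoly A B n).coeff m := by
    simp [threeTermPoly, threeTermSeq, mul_assoc]
  have hzero (l : ℕ) : (threeTermPoly A B (l + 1)).coeff 0 =
      A l * (threeTermPoly A B l).coeff 0 := by
    cases l <;> simp [threeTermPoly, threeTermSeq]
  unfold stepSum
  induction m generalizing l with
  | zero =>
    induction l with
    | zero => simp [pathSum, threeTermPoly, threeTermSeq]
    | succ l ih => rw [pathSum, ← ih]; exact hzero l
  | succ m ihm =>
    induction l with
    | zero =>
      rw [show 0 + 2 * (m + 1) = 0 + 2 * m + 2 by ring, hrec, ihm,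
        coeff_threeTermPoly_of_lt A B (by omega), mul_zero, zero_add, pathSum]
    | succ l ihl =>
      rw [show l + 1 + 2 * (m + 1) = l + 2 * m + 1 + 2 by ring, hrec,
        show l + 2 * m + 1 + 1 = l + 2 * (m + 1) by ring, ihl,
        show l + 2 * m + 1 = l + 1 + 2 * m by ring, ihm, pathSum]

end Semiring

section Ring

variable {S : Type*} [CommRing S]

/-- The failure of the sequence `c` to satisfy the three-term recurrence. -/
def recurrenceDefect (A B c : ℕ → S) : ℕ → S
  | 0 => c 1 - A 0 * c 0
  | n + 1 => c (n + 2) - (A (n + 1) * c (n + 1) + B n * c n)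

lemma recurrenceDefect_threeTermSeq (A B : ℕ → S) (n : ℕ) :
    recurrenceDefect A B (threeTermSeq A B) n = 0 := by
  cases n <;> simp [recurrenceDefect, threeTermSeq]

lemma eq_threeTermSeq {A B c : ℕ → S} (h₀ : c 0 = 1)
    (hc : ∀ n, recurrenceDefect A B c n = 0) : c = threeTermSeq A B := by
  funext n
  induction n using Nat.twoStepInduction with
  | zero => exact h₀
  | one => simpa [h₀, threeTermSeq] using sub_eq_zero.1 (hc 0)
  | more n ih ih' => rw [sub_eq_zero.1 (hc (n + 1)), ih, ih', threeTermSeq]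

end Ring

theorem hasSum_threeTermSeq_mul_pow {S : Type*} [CommSemiring S] [TopologicalSpace S]
    [IsTopologicalSemiring S] [RegularSpace S] {A B : ℕ → S} {x a : S}
    (h : HasSum (fun n : ℕ × ℕ => stepSum A B n.1 n.2 * x ^ (n.2 + 2 * n.1)) a) :
    HasSum (fun n => threeTermSeq A B n * x ^ n) a := by
  let toDegree : ℕ × ℕ → ℕ × ℕ := fun n => (n.2 + 2 * n.1, n.1)
  let g : ℕ × ℕ → S := fun n => (threeTermPoly A B n.1).coeff n.2 * x ^ n.1
  have hinj : Function.Injective toDegree := by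
    rintro ⟨a, b⟩ ⟨c, d⟩ hab
    simp only [toDegree, Prod.mk.injEq] at hab ⊢
    omega
  have hg : HasSum g a := by
    rw [← hinj.hasSum_iff]
    · simpa only [g, toDegree, Function.comp_def, coeff_threeTermPoly] using h
    · rintro ⟨n, m⟩ hnm
      have hlt : n < 2 * m := by
        by_contra! hle
        exact hnm ⟨(m, n - 2 * m), by simp only [toDegree, Prod.mk.injEq, and_true]; omega⟩
      simp only [g, coeff_threeTermPoly_of_lt A B hlt, zero_mul]
  refine hg.prod_fiberwise fun n => ?_
  rw [← eval_one_threeTermPoly, Polynomial.eval_eq_sum, Polynomial.sum_def, sum_mul]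
  simp only [one_pow, mul_one]
  refine hasSum_sum_of_ne_finset_zero fun m hm => ?_
  simp only [g, Polynomial.notMem_support_iff.1 hm, zero_mul]

section Potential

lemma exists_potential {a : ℕ → ℝ} {r : ℝ} (hr : 1 ≤ r) (ha : ∀ᶠ n in atTop, a n ≤ r) :
    ∃ P : ℕ → ℝ, (∀ n, 0 < P n) ∧ Monotone P ∧ (∀ n, a n * P n ≤ P (n + 1)) ∧
      ∃ C, 0 ≤ C ∧ ∀ n, P n ≤ C * r ^ n := by
  let P : ℕ → ℝ := fun n => ∏ j ∈ range n, max 1 (a j)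
  have hsucc : ∀ n, P (n + 1) = max 1 (a n) * P n := fun n => prod_range_succ_comm _ n
  have hpos : ∀ n, 0 < P n := fun n => prod_pos fun j _ => lt_max_of_lt_left one_pos
  have hmono : Monotone P := monotone_nat_of_le_succ fun n => by
    rw [hsucc]
    exact le_mul_of_one_le_left (hpos n).le (le_max_left _ _)
  obtain ⟨N, hN⟩ := eventually_atTop.1 ha
  refine ⟨P, hpos, hmono, fun n => ?_, P N, (hpos N).le, fun n => ?_⟩
  · rw [hsucc]
    exact mul_le_mul_of_nonneg_right (le_max_right _ _) (hpos n).le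
  · induction n with
    | zero => simpa using hmono (Nat.zero_le N)
    | succ n ih =>
      rcases le_or_gt N n with hn | hn
      · calc P (n + 1) = max 1 (a n) * P n := hsucc n
          _ ≤ r * (P N * r ^ n) := by
              have := hpos n
              gcongr
              exact max_le hr (hN n hn)
          _ = P N * r ^ (n + 1) := by ring
      · exact (hmono hn).trans (le_mul_of_one_le_right (hpos N).le (one_le_pow₀ hr))

lemma exists_pathMajorant {A : Type*} [Norm A] {a b : ℕ → A} {r : ℝ} (hr : 1 ≤ r)
    (ha : ∀ᶠ n in atTop, ‖a n‖ ≤ r) (hb : ∀ᶠ n in atTop, ‖b n‖ ≤ r) :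
    ∃ Q, PathMajorant (fun k i => a (i + 2 * k)) (fun k i => b (i + 2 * k)) Q (r ^ 2) := by
  obtain ⟨P, hpos, hmono, hP, C, hC0, hC⟩ :=
    exists_potential hr ((ha.and hb).mono fun n hn => max_le hn.1 hn.2)
  have hstep : ∀ {n n' : ℕ} {x : A}, n < n' → ‖x‖ ≤ max ‖a n‖ ‖b n‖ → ‖x‖ * P n ≤ P n' :=
    fun hn hx => ((mul_le_mul_of_nonneg_right hx (hpos _).le).trans (hP _)).trans (hmono hn)
  refine ⟨fun k i => P (i + 2 * k), fun _ _ => hpos _,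
    fun k i => hstep (by omega) (le_max_left _ _), fun k i => hstep (by omega) (le_max_right _ _),
    C, fun k i => (hC _).trans ?_⟩
  rw [← pow_mul]
  gcongr
  omega

lemma PathMajorant.swap {A : Type*} [Norm A] {f b : ℕ → ℕ → A} {Q : ℕ → ℕ → ℝ} {r : ℝ}
    (hQ : PathMajorant f b Q r) :
    PathMajorant (fun k i => b i k) (fun k i => f i k) (fun k i => Q i k) r where
  pos k i := hQ.pos i k
  right k i := hQ.up i k
  up k i := hQ.right i k
  growth := hQ.growth.imp fun C hC k i => by rw [add_comm]; exact hC i k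

end Potential

section NestedExpansions

variable {A B : ℕ → ℂ} {w : ℕ → ℕ → ℕ → ℂ} {t u : ℂ}

lemma exists_pathMajorant_of_tendsto_one (hA : Tendsto A atTop (𝓝 1)) (hB : Tendsto B atTop (𝓝 1))
    {s : ℝ} (hs : s < 1) : ∃ Q r, r * s < 1 ∧
      PathMajorant (fun k i => A (i + 2 * k)) (fun k i => B (i + 2 * k)) Q r := by
  obtain ⟨q, hqs, hq⟩ : ∃ q, q ^ 2 * s < 1 ∧ 1 < q := by
    have hcont : ContinuousAt (fun q : ℝ => q ^ 2 * s) 1 := by fun_prop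
    have hlt : ∀ᶠ q in 𝓝[>] (1 : ℝ), q ^ 2 * s < 1 :=
      nhdsWithin_le_nhds (hcont.eventually_lt_const (by simpa using hs))
    exact (hlt.and self_mem_nhdsWithin).exists
  have hnorm {a : ℕ → ℂ} (ha : Tendsto a atTop (𝓝 1)) : ∀ᶠ n in atTop, ‖a n‖ ≤ q :=
    (ha.norm.eventually_lt_const (by simpa using hq)).mono fun _ hn => hn.le
  obtain ⟨Q, hQ⟩ := exists_pathMajorant hq.le (hnorm hA) (hnorm hB)
  exact ⟨Q, q ^ 2, hqs, hQ⟩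

lemma summable_stepSum (hA : Tendsto A atTop (𝓝 1)) (hB : Tendsto B atTop (𝓝 1))
    (htu : ‖t‖ + ‖u‖ < 1) :
    Summable fun x : ℕ × ℕ => stepSum A B x.1 x.2 * t ^ x.2 * u ^ x.1 := by
  obtain ⟨Q, r, hr, hQ⟩ := exists_pathMajorant_of_tendsto_one hA hB htu
  exact hQ.summable_pathSum hr

theorem nestedConverges_of_outer_double_steps (hA : Tendsto A atTop (𝓝 1))
    (hB : Tendsto B atTop (𝓝 1)) (hw : IsPathWeight w fun k i => A (i + 2 * k))
    (htu : ‖t‖ + ‖u‖ < 1) :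
    NestedConverges w (fun k i => B (i + 2 * k)) t u ∧
      HasSum (fun m => nestedSum w (fun k i => B (i + 2 * k)) t m 0 0 * u ^ m)
        (∑' x : ℕ × ℕ, stepSum A B x.1 x.2 * t ^ x.2 * u ^ x.1) := by
  obtain ⟨Q, r, hr, hQ⟩ := exists_pathMajorant_of_tendsto_one hA hB htu
  exact hQ.nestedConverges_and_hasSum hw hr

theorem nestedConverges_of_outer_unit_steps (hA : Tendsto A atTop (𝓝 1))
    (hB : Tendsto B atTop (𝓝 1)) (hw : IsPathWeight w fun k i => B (k + 2 * i))
    (htu : ‖t‖ + ‖u‖ < 1) :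
    NestedConverges w (fun k i => A (k + 2 * i)) u t ∧
      HasSum (fun m => nestedSum w (fun k i => A (k + 2 * i)) u m 0 0 * t ^ m)
        (∑' x : ℕ × ℕ, stepSum A B x.1 x.2 * t ^ x.2 * u ^ x.1) := by
  obtain ⟨Q, r, hr, hQ⟩ := exists_pathMajorant_of_tendsto_one hA hB htu
  convert! hQ.swap.nestedConverges_and_hasSum hw (t := u) (u := t) (by rwa [add_comm]) using 2
  rw [← (Equiv.prodComm ℕ ℕ).tsum_eq]
  refine tsum_congr fun x => ?_
  rw [← stepSum_swap, mul_right_comm]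
  rfl

end NestedExpansions

end Steps

/-! ### Lamé's recurrence -/

section Weights

/-- The quotient `(a₁)_i (a₂)_i (b₁)_p (b₂)_p / ((a₁)_p (a₂)_p (b₁)_i (b₂)_i)`, of which both
`rWeight` and `tWeight` are instances. -/
def pochRatio (a₁ a₂ b₁ b₂ : ℂ) (p i : ℕ) : ℂ :=
  (poch a₁ i * poch a₂ i * poch b₁ p * poch b₂ p) /
    (poch a₁ p * poch a₂ p * poch b₁ i * poch b₂ i)

lemma poch_zero (x : ℂ) : poch x 0 = 1 := by simp [poch]

lemma poch_succ (x : ℂ) (n : ℕ) : poch x (n + 1) = poch x n * (x + n) :=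
  ascPochhammer_succ_eval n x

lemma poch_ne_zero {x : ℂ} (hx : ∀ j : ℕ, x + j ≠ 0) (n : ℕ) : poch x n ≠ 0 :=
  mt (ascPochhammer_eval_eq_zero_iff n x).1 fun ⟨j, _, hj⟩ => hx j (by rw [hj, add_neg_cancel])

lemma pochRatio_succ (a₁ a₂ b₁ b₂ : ℂ) (p i : ℕ) :
    pochRatio a₁ a₂ b₁ b₂ p (i + 1) =
      (a₁ + i) * (a₂ + i) / ((b₁ + i) * (b₂ + i)) * pochRatio a₁ a₂ b₁ b₂ p i := by
  rw [pochRatio, pochRatio, div_mul_div_comm]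
  simp only [poch_succ]
  congr 1 <;> ring

lemma isPathWeight_pochRatio {a₁ a₂ b₁ b₂ : ℕ → ℂ}
    (ha : ∀ k j : ℕ, (a₁ (k + 1) + j) * (a₂ (k + 1) + j) ≠ 0)
    (hb : ∀ k j : ℕ, (b₁ (k + 1) + j) * (b₂ (k + 1) + j) ≠ 0) :
    IsPathWeight (fun k => pochRatio (a₁ k) (a₂ k) (b₁ k) (b₂ k))
      fun k i => (a₁ k + i) * (a₂ k + i) / ((b₁ k + i) * (b₂ k + i)) where
  succ k p j := pochRatio_succ _ _ _ _ p (p + j)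
  self k p := div_self <| mul_ne_zero (mul_ne_zero (mul_ne_zero
    (poch_ne_zero (fun j => left_ne_zero_of_mul (ha k j)) p)
    (poch_ne_zero (fun j => right_ne_zero_of_mul (ha k j)) p))
    (poch_ne_zero (fun j => left_ne_zero_of_mul (hb k j)) p))
    (poch_ne_zero (fun j => right_ne_zero_of_mul (hb k j)) p)
  zero := by simp [pochRatio, poch_zero]

lemma add_natCast_ne_zero {x : ℂ} (hx : 0 < x.re) (n : ℕ) : x + n ≠ 0 := fun h => by
  have hre : x.re + n = 0 := by simpa using congrArg Complex.re h
  linarith [n.cast_nonneg (α := ℝ)]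

lemma root_sq (ρ h : ℝ) : root ρ h ^ 2 = h / (4 * (1 + (ρ : ℂ) ^ 2)) := by
  rw [root, one_div, Complex.cpow_ofNat_inv_pow]
  push_cast
  rfl

/-- The factor of `η` contributed by a unit step leaving `n` in the recurrence for the coefficients
of the local solution. -/
def etaStep (ρ h : ℝ) (n : ℕ) : ℂ := (n - root ρ h) * (n + root ρ h) / ((n + 1) * (n + 1 / 2))

/-- The factor of `z` contributed by a double step leaving `n` in the recurrence for the
coefficients of the local solution. -/
def zStep (α : ℝ) (n : ℕ) : ℂ := (n + α / 2 + 1 / 2) * (n - α / 2) / ((n + 2) * (n + 3 / 2))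

lemma rFactor_eq (α : ℝ) : rFactor α = fun k i => zStep α (i + 2 * k) := by
  funext k i
  simp only [rFactor, zStep, Nat.cast_add, Nat.cast_mul, Nat.cast_ofNat]

lemma tFactor_eq (ρ h : ℝ) : tFactor ρ h = fun k i => etaStep ρ h (k + 2 * i) := by
  funext k i
  have hroot : (h : ℂ) / (16 * (1 + (ρ : ℂ) ^ 2)) = root ρ h ^ 2 / 4 := by
    rw [root_sq, div_div]
    ring
  rw [tFactor, etaStep, hroot, ← mul_div_mul_left _ _ (show (4 : ℂ) ≠ 0 by norm_num)]
  push_cast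
  congr 1 <;> ring

lemma deltaMinus_add_mul_deltaPlus_add_ne_zero {ρ h : ℝ}
    (hh : ∀ m : ℕ, 2 ≤ m → h ≠ 4 * (1 + ρ ^ 2) * (m : ℝ) ^ 2) (k j : ℕ) :
    (DeltaMinus ρ h (k + 1) + j) * (DeltaPlus ρ h (k + 1) + j) ≠ 0 := by
  have hρ : 4 * (1 + ρ ^ 2) ≠ 0 := by positivity
  have hm : ((2 * (k + 1) + j : ℕ) : ℂ) ^ 2 - root ρ h ^ 2 ≠ 0 := by
    rw [sub_ne_zero, root_sq]
    intro he
    refine hh (2 * (k + 1) + j) (by omega) ((div_eq_iff hρ).1 ?_ |>.trans (mul_comm _ _))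
    exact_mod_cast he.symm
  convert! hm using 1
  simp only [DeltaMinus, DeltaPlus]
  push_cast
  ring

lemma isPathWeight_rWeight {ρ h : ℝ}
    (hh : ∀ m : ℕ, 2 ≤ m → h ≠ 4 * (1 + ρ ^ 2) * (m : ℝ) ^ 2) :
    IsPathWeight (rWeight ρ h) fun k i => etaStep ρ h (i + 2 * k) := by
  convert! isPathWeight_pochRatio (b₁ := fun k => 2 * k + 1) (b₂ := fun k => 2 * k + 1 / 2)
    (deltaMinus_add_mul_deltaPlus_add_ne_zero hh) fun k j => ?_ using 3 with k i
  · simp only [etaStep, DeltaMinus, DeltaPlus]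
    push_cast
    congr 1 <;> ring
  · have hre₁ : (0 : ℝ) < 2 * (k + 1) + 1 := by positivity
    have hre₂ : (0 : ℝ) < 2 * (k + 1) + 1 / 2 := by positivity
    exact mul_ne_zero (add_natCast_ne_zero (by simpa using hre₁) j)
      (add_natCast_ne_zero (by simpa using hre₂) j)

lemma isPathWeight_tWeight {α : ℝ}
    (hα : ∀ m : ℕ, 1 ≤ m → α ≠ 2 * (m : ℝ) ∧ α ≠ -(2 * (m : ℝ) + 1)) :
    IsPathWeight (tWeight α) fun k i => zStep α (k + 2 * i) := by
  convert! isPathWeight_pochRatio (a₁ := fun k => k / 2 - α / 4)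
    (a₂ := fun k => k / 2 + α / 4 + 1 / 4) (b₁ := fun k => k / 2 + 1)
    (b₂ := fun k => k / 2 + 3 / 4) (fun k j => ?_) fun k j => ?_ using 3 with k i
  · rw [eq_comm, ← mul_div_mul_left _ _ (show (4 : ℂ) ≠ 0 by norm_num), zStep]
    push_cast
    congr 1 <;> ring
  · obtain ⟨hα₁, hα₂⟩ := hα (k + 1 + 2 * j) (by omega)
    refine mul_ne_zero (fun he => hα₁ ?_) fun he => hα₂ ?_
    · apply Complex.ofReal_injective
      push_cast at he ⊢
      linear_combination -4 * he
    · apply Complex.ofReal_injective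
      push_cast at he ⊢
      linear_combination 4 * he
  · have hre₁ : (0 : ℝ) < (k + 1) / 2 + 1 := by positivity
    have hre₂ : (0 : ℝ) < (k + 1) / 2 + 3 / 4 := by positivity
    exact mul_ne_zero (add_natCast_ne_zero (by simpa using hre₁) j)
      (add_natCast_ne_zero (by simpa using hre₂) j)

lemma tendsto_natCast_add_div_natCast_add (a b : ℂ) :
    Tendsto (fun n : ℕ => (n + a) / (n + b)) atTop (𝓝 1) := by
  simpa [add_comm] using tendsto_add_mul_div_add_mul_atTop_nhds a b (1 : ℂ) one_ne_zero

lemma tendsto_etaStep (ρ h : ℝ) : Tendsto (etaStep ρ h) atTop (𝓝 1) := by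
  have hlim := (tendsto_natCast_add_div_natCast_add (-root ρ h) 1).mul
    (tendsto_natCast_add_div_natCast_add (root ρ h) (1 / 2))
  rw [mul_one] at hlim
  exact hlim.congr fun n => by rw [div_mul_div_comm, ← sub_eq_add_neg, etaStep]

lemma tendsto_zStep (α : ℝ) : Tendsto (zStep α) atTop (𝓝 1) := by
  have hlim := (tendsto_natCast_add_div_natCast_add (α / 2 + 1 / 2) 2).mul
    (tendsto_natCast_add_div_natCast_add (-(α / 2)) (3 / 2))
  rw [mul_one] at hlim
  exact hlim.congr fun n => by rw [div_mul_div_comm, ← sub_eq_add_neg, ← add_assoc, zStep]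

end Weights

section Expansions

variable {ρ α h : ℝ} {t u : ℂ}

theorem nestedConverges_rWeight
    (hh : ∀ m : ℕ, 2 ≤ m → h ≠ 4 * (1 + ρ ^ 2) * (m : ℝ) ^ 2) (htu : ‖t‖ + ‖u‖ < 1) :
    NestedConverges (rWeight ρ h) (rFactor α) t u ∧
      HasSum (fun m => nestedSum (rWeight ρ h) (rFactor α) t m 0 0 * u ^ m)
        (∑' x : ℕ × ℕ, stepSum (etaStep ρ h) (zStep α) x.1 x.2 * t ^ x.2 * u ^ x.1) := by
  rw [rFactor_eq]
  exact nestedConverges_of_outer_double_steps (tendsto_etaStep ρ h) (tendsto_zStep α)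
    (isPathWeight_rWeight hh) htu

theorem nestedConverges_tWeight
    (hα : ∀ m : ℕ, 1 ≤ m → α ≠ 2 * (m : ℝ) ∧ α ≠ -(2 * (m : ℝ) + 1)) (htu : ‖t‖ + ‖u‖ < 1) :
    NestedConverges (tWeight α) (tFactor ρ h) u t ∧
      HasSum (fun m => nestedSum (tWeight α) (tFactor ρ h) u m 0 0 * t ^ m)
        (∑' x : ℕ × ℕ, stepSum (etaStep ρ h) (zStep α) x.1 x.2 * t ^ x.2 * u ^ x.1) := by
  rw [tFactor_eq]
  exact nestedConverges_of_outer_unit_steps (tendsto_etaStep ρ h) (tendsto_zStep α)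
    (isPathWeight_tWeight hα) htu

theorem LFR_eq_LF (hh : ∀ m : ℕ, 2 ≤ m → h ≠ 4 * (1 + ρ ^ 2) * (m : ℝ) ^ 2)
    (hα : ∀ m : ℕ, 1 ≤ m → α ≠ 2 * (m : ℝ) ∧ α ≠ -(2 * (m : ℝ) + 1)) {ξ : ℂ}
    (hξ : ξ ∈ domain ρ) : LFR ρ α h ξ = LF ρ α h ξ :=
  (nestedConverges_rWeight hh hξ).2.tsum_eq.trans (nestedConverges_tWeight hα hξ).2.tsum_eq.symm

/-- The weight of a unit step in the recurrence for the power series in `ξ`. -/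
def unitStep (ρ h : ℝ) (n : ℕ) : ℂ := (1 + (ρ : ℂ) ^ 2) * etaStep ρ h n

/-- The weight of a double step in the recurrence for the power series in `ξ`. -/
def doubleStep (ρ α : ℝ) (n : ℕ) : ℂ := -(ρ : ℂ) ^ 2 * zStep α n

/-- The coefficients of the power series in `ξ` of the normalized local solution. -/
def lameSeries (ρ α h : ℝ) : ℕ → ℂ := threeTermSeq (unitStep ρ h) (doubleStep ρ α)

theorem hasSum_lameSeries (hh : ∀ m : ℕ, 2 ≤ m → h ≠ 4 * (1 + ρ ^ 2) * (m : ℝ) ^ 2) {ξ : ℂ}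
    (hξ : ξ ∈ domain ρ) : HasSum (fun n => lameSeries ρ α h n * ξ ^ n) (LFR ρ α h ξ) := by
  rw [LFR, (nestedConverges_rWeight hh hξ).2.tsum_eq]
  refine hasSum_threeTermSeq_mul_pow ?_
  convert! (summable_stepSum (tendsto_etaStep ρ h) (tendsto_zStep α) hξ).hasSum using 2 with x
  rw [show stepSum (unitStep ρ h) (doubleStep ρ α) x.1 x.2 = _ from stepSum_const_mul _ _ _ _ _ _,
    eta, zvar, mul_pow, mul_pow]
  ring

lemma unitStep_mul (ρ h : ℝ) (n : ℕ) :
    (n + 1) * (n + 1 / 2) * unitStep ρ h n = (1 + (ρ : ℂ) ^ 2) * n ^ 2 - h / 4 := by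
  have hρ : 1 + (ρ : ℂ) ^ 2 ≠ 0 := by
    have : 1 + ρ ^ 2 ≠ 0 := by positivity
    exact_mod_cast this
  have hn : (n + 1 : ℂ) * (n + 1 / 2) ≠ 0 := mul_ne_zero n.cast_add_one_ne_zero
    (add_comm (n : ℂ) _ ▸ add_natCast_ne_zero (by norm_num) n)
  have hnum : (n - root ρ h) * (n + root ρ h) = n ^ 2 - h / (4 * (1 + (ρ : ℂ) ^ 2)) := by
    rw [← root_sq]
    ring
  rw [unitStep, etaStep, hnum, mul_left_comm, mul_div_cancel₀ _ hn]
  field_simp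

lemma doubleStep_mul (ρ α : ℝ) (n : ℕ) :
    (n + 2) * (n + 3 / 2) * doubleStep ρ α n =
      -(ρ : ℂ) ^ 2 * (n * (n + 1 / 2) - α * (α + 1) / 4) := by
  have hn : (n + 2 : ℂ) * (n + 3 / 2) ≠ 0 := mul_ne_zero
    (add_comm (n : ℂ) _ ▸ add_natCast_ne_zero (by norm_num) n)
    (add_comm (n : ℂ) _ ▸ add_natCast_ne_zero (by norm_num) n)
  rw [doubleStep, zStep, mul_left_comm, mul_div_cancel₀ _ hn]
  ring

end Expansions

/-! ### Power series solutions of Lamé's equation -/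

section PowerSeries

variable {c : ℕ → ℂ} {y : ℂ → ℂ} {r : ℝ} {a ξ : ℂ}

lemma eq_coeff_zero_of_hasSum (h : HasSum (fun n => c n * (0 : ℂ) ^ n) a) : a = c 0 := by
  have hsingle : HasSum (fun n => c n * (0 : ℂ) ^ n) (c 0 * 0 ^ 0) :=
    hasSum_single 0 fun n hn => by simp [hn]
  simpa using h.unique hsingle

lemma hasFPowerSeriesOnBall_of_hasSum (hr : 0 < r)
    (hy : ∀ ξ ∈ Metric.ball (0 : ℂ) r, HasSum (fun n => c n * ξ ^ n) (y ξ)) :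
    HasFPowerSeriesOnBall y (FormalMultilinearSeries.ofScalars ℂ c) 0 (ENNReal.ofReal r) where
  r_le := by
    refine ENNReal.le_of_forall_nnreal_lt fun s hs => ?_
    rw [← ENNReal.ofReal_coe_nnreal, ENNReal.ofReal_lt_ofReal_iff hr] at hs
    have hsum := (hy (s : ℝ) (by simpa using hs)).summable.norm
    exact FormalMultilinearSeries.le_radius_of_summable _
      (by simpa [FormalMultilinearSeries.ofScalars_norm] using hsum)
  r_pos := by simpa using hr
  hasSum {ξ} hξ := by
    rw [Metric.eball_ofReal] at hξ
    simpa [FormalMultilinearSeries.ofScalars_apply_eq, mul_comm] using hy ξ hξ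

lemma exists_hasSum_of_analyticAt (hy : AnalyticAt ℂ y 0) : ∃ (c : ℕ → ℂ) (r : ℝ), 0 < r ∧
    ∀ ξ ∈ Metric.ball (0 : ℂ) r, HasSum (fun n => c n * ξ ^ n) (y ξ) := by
  obtain ⟨p, R, hp⟩ := hy
  obtain ⟨r, hr, hrR⟩ := ENNReal.lt_iff_exists_nnreal_btwn.1 hp.r_pos
  refine ⟨p.coeff, r, by simpa using hr, fun ξ hξ => ?_⟩
  rw [← Metric.eball_ofReal, ENNReal.ofReal_coe_nnreal] at hξ
  simpa [FormalMultilinearSeries.apply_eq_pow_smul_coeff, mul_comm] using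
    hp.hasSum (Metric.eball_subset_eball hrR.le hξ)

lemma coeff_eq_zero_of_eventually_eq_zero (hr : 0 < r)
    (hy : ∀ ξ ∈ Metric.ball (0 : ℂ) r, HasSum (fun n => c n * ξ ^ n) (y ξ))
    (hzero : ∀ᶠ ξ in 𝓝[≠] (0 : ℂ), y ξ = 0) : c = 0 := by
  have hseries := (hasFPowerSeriesOnBall_of_hasSum hr hy).hasFPowerSeriesAt
  have hy0 := hseries.analyticAt.frequently_zero_iff_eventually_zero.1 hzero.frequently
  exact (FormalMultilinearSeries.ofScalars_series_eq_zero ℂ).1 (hseries.congr hy0).eq_zero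

lemma hasSum_deriv (hr : 0 < r)
    (hy : ∀ ξ ∈ Metric.ball (0 : ℂ) r, HasSum (fun n => c n * ξ ^ n) (y ξ)) :
    ∀ ξ ∈ Metric.ball (0 : ℂ) r,
      HasSum (fun n : ℕ => (n + 1) * c (n + 1) * ξ ^ n) (deriv y ξ) := by
  intro ξ hξ
  have hfderiv := (hasFPowerSeriesOnBall_of_hasSum hr hy).fderiv.hasSum (y := ξ)
    (by rwa [Metric.eball_ofReal])
  have hderiv := hfderiv.mapL (ContinuousLinearMap.apply ℂ ℂ (1 : ℂ))
  simp only [zero_add, ContinuousLinearMap.apply_apply, fderiv_apply_one_eq_deriv] at hderiv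
  convert! hderiv using 2 with n
  rw [FormalMultilinearSeries.apply_eq_pow_smul_coeff, smul_apply,
    FormalMultilinearSeries.derivSeries_coeff_one, FormalMultilinearSeries.coeff_ofScalars]
  simp only [nsmul_eq_mul, smul_eq_mul]
  push_cast
  ring

lemma hasSum_of_hasSum_succ {g : ℕ → ℂ} (h₀ : g 0 = 0) (h : HasSum (fun n => g (n + 1)) a) :
    HasSum g a := by
  simpa [h₀] using (hasSum_nat_add_iff 1).1 h

lemma hasSum_mul_of_hasSum_deriv (h : HasSum (fun n : ℕ => (n + 1) * c (n + 1) * ξ ^ n) a) :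
    HasSum (fun n : ℕ => n * c n * ξ ^ n) (ξ * a) := by
  refine hasSum_of_hasSum_succ (by simp) ?_
  convert! h.mul_left ξ using 2 with n
  push_cast
  ring

end PowerSeries

section LameOperator

variable {ρ α h : ℝ} {y : ℂ → ℂ}

/-- Lamé's operator in algebraic form, multiplied by `ξ (1 - ξ) (1 - ρ² ξ)` to clear the
denominators. -/
def lameOp (ρ α h : ℝ) (y : ℂ → ℂ) (ξ : ℂ) : ℂ :=
  ξ * (1 - ξ) * (1 - (ρ : ℂ) ^ 2 * ξ) * deriv (deriv y) ξ
    + 1 / 2 * (1 - 2 * (1 + (ρ : ℂ) ^ 2) * ξ + 3 * (ρ : ℂ) ^ 2 * ξ ^ 2) * deriv y ξ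
    + 1 / 4 * (h - α * (α + 1) * (ρ : ℂ) ^ 2 * ξ) * y ξ

lemma lameEqAt_iff (hρ : ρ ≠ 0) {ξ : ℂ} (h₀ : ξ ≠ 0) (h₁ : ξ ≠ 1) (h₂ : (ρ : ℂ) ^ 2 * ξ ≠ 1) :
    LameEqAt ρ α h y ξ ↔ lameOp ρ α h y ξ = 0 := by
  have hρ' : (ρ : ℂ) ≠ 0 := Complex.ofReal_ne_zero.2 hρ
  have h₁' : ξ - 1 ≠ 0 := sub_ne_zero.2 h₁
  have h₂' : ξ * (ρ : ℂ) ^ 2 - 1 ≠ 0 := sub_ne_zero.2 (by rwa [mul_comm])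
  have hinv : ξ - ((ρ : ℂ) ^ 2)⁻¹ = (ξ * (ρ : ℂ) ^ 2 - 1) / (ρ : ℂ) ^ 2 := by field_simp
  have hclear : lameOp ρ α h y ξ = ξ * (ξ - 1) * (ξ * (ρ : ℂ) ^ 2 - 1) * (deriv (deriv y) ξ
      + 1 / 2 * (1 / ξ + 1 / (ξ - 1) + 1 / (ξ - ((ρ : ℂ) ^ 2)⁻¹)) * deriv y ξ
      + (-(α * (α + 1)) * ξ + h * ((ρ : ℂ) ^ 2)⁻¹) /
          (4 * ξ * (ξ - 1) * (ξ - ((ρ : ℂ) ^ 2)⁻¹)) * y ξ) := by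
    rw [lameOp, hinv]
    field_simp
    ring
  rw [hclear, mul_eq_zero, or_iff_right (mul_ne_zero (mul_ne_zero h₀ h₁') h₂'), LameEqAt]

lemma recurrenceDefect_zero_mul (ρ α h : ℝ) (c : ℕ → ℂ) :
    1 / 2 * recurrenceDefect (unitStep ρ h) (doubleStep ρ α) c 0 =
      1 / 2 * c 1 + h / 4 * c 0 := by
  have hunit := unitStep_mul ρ h 0
  simp only [recurrenceDefect, Nat.cast_zero, zero_add] at hunit ⊢
  linear_combination -c 0 * hunit

lemma recurrenceDefect_succ_mul (ρ α h : ℝ) (c : ℕ → ℂ) (n : ℕ) :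
    (n + 2) * (n + 3 / 2) * recurrenceDefect (unitStep ρ h) (doubleStep ρ α) c (n + 1) =
      (n + 2) * (n + 3 / 2) * c (n + 2) - ((1 + (ρ : ℂ) ^ 2) * (n + 1) ^ 2 - h / 4) * c (n + 1)
        + (ρ : ℂ) ^ 2 * (n * (n + 1 / 2) - α * (α + 1) / 4) * c n := by
  have hunit := unitStep_mul ρ h (n + 1)
  have hdouble := doubleStep_mul ρ α n
  simp only [recurrenceDefect]
  push_cast at hunit ⊢
  linear_combination -c (n + 1) * hunit - c n * hdouble

/-- With `θ = ξ d/dξ`, Lamé's operator multiplied by `ξ` is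
`θ (θ - 1/2) - ξ ((1 + ρ²) θ² - h/4) + ρ² ξ² (θ (θ + 1/2) - α (α + 1)/4)`. -/
theorem hasSum_lameOp {c : ℕ → ℂ} {r : ℝ} (ρ α h : ℝ) (hr : 0 < r)
    (hy : ∀ ξ ∈ Metric.ball (0 : ℂ) r, HasSum (fun n => c n * ξ ^ n) (y ξ)) :
    ∀ ξ ∈ Metric.ball (0 : ℂ) r, HasSum (fun n : ℕ => (n + 1) * (n + 1 / 2) *
      recurrenceDefect (unitStep ρ h) (doubleStep ρ α) c n * ξ ^ n) (lameOp ρ α h y ξ) := by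
  intro ξ hξ
  have hy₀ := hy ξ hξ
  have hy₁ := hasSum_deriv hr hy ξ hξ
  have hy₂ := hasSum_deriv (c := fun n => (n + 1) * c (n + 1)) hr (hasSum_deriv hr hy) ξ hξ
  have hξy₁ := hasSum_mul_of_hasSum_deriv hy₁
  have hξy₂ := hasSum_mul_of_hasSum_deriv (c := fun n => (n + 1) * c (n + 1)) hy₂
  have hξξy₂ : HasSum (fun n : ℕ => n * (n - 1) * c n * ξ ^ n) (ξ * (ξ * deriv (deriv y) ξ)) := by
    refine hasSum_of_hasSum_succ (by simp) ?_
    convert! hξy₂.mul_left ξ using 2 with n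
    push_cast
    ring
  have hlow := ((hξy₂.add (hy₁.mul_left (1 / 2))).sub
    (((hξξy₂.add hξy₁).mul_left (1 + (ρ : ℂ) ^ 2)).sub (hy₀.mul_left ((h : ℂ) / 4)))).congr_fun
    (g := fun n : ℕ => ((n + 1) * (n + 1 / 2) * c (n + 1)
      - ((1 + (ρ : ℂ) ^ 2) * n ^ 2 - h / 4) * c n) * ξ ^ n) fun n => by ring
  have hhigh := ((hξξy₂.add (hξy₁.mul_left (3 / 2))).sub
    (hy₀.mul_left ((α : ℂ) * (α + 1) / 4))).mul_left ((ρ : ℂ) ^ 2 * ξ)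
  have hshift := hasSum_of_hasSum_succ
    (g := fun n : ℕ => ((n + 1) * (n + 1 / 2) *
      recurrenceDefect (unitStep ρ h) (doubleStep ρ α) c n - ((n + 1) * (n + 1 / 2) * c (n + 1)
        - ((1 + (ρ : ℂ) ^ 2) * n ^ 2 - h / 4) * c n)) * ξ ^ n)
    (by linear_combination (norm := (push_cast; ring)) recurrenceDefect_zero_mul ρ α h c)
    (hhigh.congr_fun fun n => by
      linear_combination (norm := (push_cast; ring))
        ξ ^ (n + 1) * recurrenceDefect_succ_mul ρ α h c n)
  convert! hshift.add hlow using 1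
  · funext n
    ring
  · rw [lameOp]
    ring

end LameOperator

/-! ### The local solution at the origin -/

section Domain

variable {ρ : ℝ} {ξ : ℂ}

lemma mem_domain_iff : ξ ∈ domain ρ ↔ (1 + ‖ξ‖) * (1 + ρ ^ 2 * ‖ξ‖) < 2 := by
  have hcoeff : ‖1 + (ρ : ℂ) ^ 2‖ = 1 + ρ ^ 2 := by
    rw [← Complex.ofReal_one, ← Complex.ofReal_pow, ← Complex.ofReal_add, Complex.norm_real,
      Real.norm_of_nonneg (by positivity)]
  rw [domain, Set.mem_ofPred_eq, eta, zvar, norm_mul, norm_mul, hcoeff, norm_neg, norm_pow,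
    norm_pow, Complex.norm_real, Real.norm_eq_abs, sq_abs]
  constructor <;> intro h <;> linarith

lemma zero_mem_domain (ρ : ℝ) : (0 : ℂ) ∈ domain ρ := by simp [domain, eta, zvar]

lemma isOpen_domain (ρ : ℝ) : IsOpen (domain ρ) := by
  simp only [domain, eta, zvar]
  exact isOpen_lt (by fun_prop) continuous_const

lemma ne_one_of_mem_domain (hξ : ξ ∈ domain ρ) : ξ ≠ 1 := by
  rintro rfl
  rw [mem_domain_iff, norm_one] at hξ
  linarith [sq_nonneg ρ]

lemma sq_mul_ne_one_of_mem_domain (hξ : ξ ∈ domain ρ) : (ρ : ℂ) ^ 2 * ξ ≠ 1 := by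
  intro heq
  have hnorm : ρ ^ 2 * ‖ξ‖ = 1 := by simpa using congrArg norm heq
  rw [mem_domain_iff, hnorm] at hξ
  linarith [norm_nonneg ξ]

lemma exists_ball_subset_domain (hξ : ξ ∈ domain ρ) :
    ∃ r, 0 < r ∧ ξ ∈ Metric.ball (0 : ℂ) r ∧ Metric.ball (0 : ℂ) r ⊆ domain ρ := by
  have hcont : Continuous fun s : ℝ => (1 + s) * (1 + ρ ^ 2 * s) := by fun_prop
  have hnear : ∀ᶠ s in 𝓝[>] ‖ξ‖, (1 + s) * (1 + ρ ^ 2 * s) < 2 :=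
    nhdsWithin_le_nhds ((hcont.tendsto ‖ξ‖).eventually_lt_const (mem_domain_iff.1 hξ))
  obtain ⟨r, hr, hξr⟩ := (hnear.and self_mem_nhdsWithin).exists
  have hr₀ : 0 < r := (norm_nonneg ξ).trans_lt hξr
  refine ⟨r, hr₀, mem_ball_zero_iff.2 hξr, fun ζ hζ => ?_⟩
  have hζr := (mem_ball_zero_iff.1 hζ).le
  refine mem_domain_iff.2 (lt_of_le_of_lt ?_ hr)
  gcongr

end Domain

section LocalSolution

variable {ρ α h : ℝ} (hh : ∀ m : ℕ, 2 ≤ m → h ≠ 4 * (1 + ρ ^ 2) * (m : ℝ) ^ 2)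

include hh

theorem analyticOnNhd_LFR : AnalyticOnNhd ℂ (LFR ρ α h) (domain ρ) := by
  intro ξ hξ
  obtain ⟨r, hr, hξr, hsub⟩ := exists_ball_subset_domain hξ
  refine (hasFPowerSeriesOnBall_of_hasSum hr
    fun ζ hζ => hasSum_lameSeries (α := α) hh (hsub hζ)).analyticOnNhd ξ ?_
  rwa [Metric.eball_ofReal]

theorem LFR_zero : LFR ρ α h 0 = 1 :=
  eq_coeff_zero_of_hasSum (hasSum_lameSeries hh (zero_mem_domain ρ))

theorem lameOp_LFR {ξ : ℂ} (hξ : ξ ∈ domain ρ) : lameOp ρ α h (LFR ρ α h) ξ = 0 := by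
  obtain ⟨r, hr, hξr, hsub⟩ := exists_ball_subset_domain hξ
  have hsum := hasSum_lameOp ρ α h hr (fun ζ hζ => hasSum_lameSeries (α := α) hh (hsub hζ)) ξ hξr
  simp only [lameSeries, recurrenceDefect_threeTermSeq, mul_zero, zero_mul] at hsum
  exact hsum.unique hasSum_zero

theorem lameEqAt_LFR (hρ : ρ ≠ 0) {ξ : ℂ} (hξ : ξ ∈ domain ρ) (h₀ : ξ ≠ 0) :
    LameEqAt ρ α h (LFR ρ α h) ξ :=
  (lameEqAt_iff hρ h₀ (ne_one_of_mem_domain hξ) (sq_mul_ne_one_of_mem_domain hξ)).2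
    (lameOp_LFR hh hξ)

theorem eventuallyEq_LFR (hρ : ρ ≠ 0) {y : ℂ → ℂ} (hy : AnalyticAt ℂ y 0) (hy₀ : y 0 = 1)
    (heq : ∀ᶠ ξ in 𝓝[≠] (0 : ℂ), LameEqAt ρ α h y ξ) : y =ᶠ[𝓝 0] LFR ρ α h := by
  obtain ⟨c, r, hr, hc⟩ := exists_hasSum_of_analyticAt hy
  have hdomain : ∀ᶠ ξ in 𝓝 (0 : ℂ), ξ ∈ domain ρ := (isOpen_domain ρ).mem_nhds (zero_mem_domain ρ)
  have hzero : ∀ᶠ ξ in 𝓝[≠] (0 : ℂ), lameOp ρ α h y ξ = 0 := by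
    filter_upwards [heq, nhdsWithin_le_nhds hdomain, self_mem_nhdsWithin] with ξ hξ hξD hξ₀
    exact (lameEqAt_iff hρ hξ₀ (ne_one_of_mem_domain hξD) (sq_mul_ne_one_of_mem_domain hξD)).1 hξ
  have hdefect : ∀ n, recurrenceDefect (unitStep ρ h) (doubleStep ρ α) c n = 0 := fun n => by
    have hcoeff := congrFun (coeff_eq_zero_of_eventually_eq_zero hr
      (hasSum_lameOp ρ α h hr hc) hzero) n
    refine (mul_eq_zero.1 hcoeff).resolve_left (mul_ne_zero (Nat.cast_add_one_ne_zero n) ?_)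
    rw [add_comm]
    exact add_natCast_ne_zero (by norm_num) n
  have hc₀ : c 0 = 1 := by
    rw [← eq_coeff_zero_of_hasSum (hc 0 (Metric.mem_ball_self hr)), hy₀]
  have hcL : c = lameSeries ρ α h := eq_threeTermSeq hc₀ hdefect
  filter_upwards [Metric.ball_mem_nhds (0 : ℂ) hr, hdomain] with ξ hξ hξD
  exact (hcL ▸ hc ξ hξ).unique (hasSum_lameSeries hh hξD)

end LocalSolution

/-! ### Weierstrass's form -/

section Sn

variable {ρ s u : ℝ}

/-- The polynomial `(1 - s²) (1 - ρ² s²)`, the square of `sn'` as a function of `s = sn`. -/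
def snQuartic (ρ s : ℝ) : ℝ := (1 - s ^ 2) * (1 - ρ ^ 2 * s ^ 2)

lemma hasDerivAt_snQuartic (ρ s : ℝ) :
    HasDerivAt (snQuartic ρ) (2 * (-(1 + ρ ^ 2) * s + 2 * ρ ^ 2 * s ^ 3)) s := by
  convert! ((hasDerivAt_pow 2 s).const_sub 1).mul
    (((hasDerivAt_pow 2 s).const_mul (ρ ^ 2)).const_sub 1) using 1
  push_cast
  ring

lemma sn_mem (hu : u ∈ snDomain ρ) : sn ρ u ∈ Set.Ioo (-1 : ℝ) 1 :=
  Function.invFunOn_mem hu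

lemma ellipticF_sn (hu : u ∈ snDomain ρ) : ellipticF ρ (sn ρ u) = u :=
  Function.invFunOn_eq hu

variable (hρ : |ρ| ≤ 1)

include hρ

lemma snQuartic_pos (hs : s ∈ Set.Ioo (-1 : ℝ) 1) : 0 < snQuartic ρ s := by
  have hs₁ : s ^ 2 < 1 := (sq_lt_one_iff_abs_lt_one s).2 (abs_lt.2 hs)
  have hρs : ρ ^ 2 * s ^ 2 ≤ s ^ 2 :=
    mul_le_of_le_one_left (sq_nonneg s) ((sq_le_one_iff_abs_le_one ρ).2 hρ)
  exact mul_pos (by linarith) (by linarith)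

lemma one_div_sqrt_snQuartic_pos (hs : s ∈ Set.Ioo (-1 : ℝ) 1) : 0 < 1 / √(snQuartic ρ s) :=
  one_div_pos.2 (Real.sqrt_pos.2 (snQuartic_pos hρ hs))

lemma hasStrictDerivAt_ellipticF (hs : s ∈ Set.Ioo (-1 : ℝ) 1) :
    HasStrictDerivAt (ellipticF ρ) (1 / √(snQuartic ρ s)) s := by
  have hcont : ContinuousOn (fun t => 1 / √(snQuartic ρ t)) (Set.Ioo (-1 : ℝ) 1) := by
    refine continuousOn_const.div ?_ fun t ht => (Real.sqrt_pos.2 (snQuartic_pos hρ ht)).ne'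
    unfold snQuartic
    fun_prop
  have hsub : Set.uIcc 0 s ⊆ Set.Ioo (-1 : ℝ) 1 :=
    Set.ordConnected_Ioo.uIcc_subset (by norm_num) hs
  exact intervalIntegral.integral_hasStrictDerivAt_right (hcont.mono hsub).intervalIntegrable
    (hcont.stronglyMeasurableAtFilter isOpen_Ioo s hs) (hcont.continuousAt (isOpen_Ioo.mem_nhds hs))

lemma injOn_ellipticF : Set.InjOn (ellipticF ρ) (Set.Ioo (-1) 1) := by
  refine (strictMonoOn_of_deriv_pos (convex_Ioo (-1 : ℝ) 1)
    (fun s hs => (hasStrictDerivAt_ellipticF hρ hs).hasDerivAt.continuousAt.continuousWithinAt)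
    fun s hs => ?_).injOn
  rw [interior_Ioo] at hs
  rw [(hasStrictDerivAt_ellipticF hρ hs).hasDerivAt.deriv]
  exact one_div_sqrt_snQuartic_pos hρ hs

lemma map_nhds_ellipticF (hs : s ∈ Set.Ioo (-1 : ℝ) 1) :
    map (ellipticF ρ) (𝓝 s) = 𝓝 (ellipticF ρ s) :=
  (hasStrictDerivAt_ellipticF hρ hs).map_nhds_eq (one_div_sqrt_snQuartic_pos hρ hs).ne'

lemma isOpen_snDomain : IsOpen (snDomain ρ) := by
  rw [isOpen_iff_mem_nhds]
  rintro _ ⟨s, hs, rfl⟩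
  rw [← map_nhds_ellipticF hρ hs]
  exact image_mem_map (isOpen_Ioo.mem_nhds hs)

lemma continuousAt_sn (hu : u ∈ snDomain ρ) : ContinuousAt (sn ρ) u := by
  have hs := sn_mem hu
  have hlim : Tendsto (sn ρ) (𝓝 (ellipticF ρ (sn ρ u))) (𝓝 (sn ρ u)) := by
    rw [← map_nhds_ellipticF hρ hs, tendsto_map'_iff]
    refine tendsto_id.congr' ?_
    filter_upwards [isOpen_Ioo.mem_nhds hs] with t ht
    exact ((injOn_ellipticF hρ).leftInvOn_invFunOn ht).symm
  rwa [ellipticF_sn hu] at hlim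

lemma hasDerivAt_sn (hu : u ∈ snDomain ρ) :
    HasDerivAt (sn ρ) (√(snQuartic ρ (sn ρ u))) u := by
  have hs := sn_mem hu
  simpa using HasDerivAt.of_local_left_inverse (continuousAt_sn hρ hu)
    (hasStrictDerivAt_ellipticF hρ hs).hasDerivAt (one_div_sqrt_snQuartic_pos hρ hs).ne'
    (eventually_of_mem ((isOpen_snDomain hρ).mem_nhds hu) fun v hv => ellipticF_sn hv)

lemma hasDerivAt_sqrt_snQuartic_sn (hu : u ∈ snDomain ρ) :
    HasDerivAt (fun v => √(snQuartic ρ (sn ρ v)))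
      (-(1 + ρ ^ 2) * sn ρ u + 2 * ρ ^ 2 * sn ρ u ^ 3) u := by
  have hpos := snQuartic_pos hρ (sn_mem hu)
  have hsqrt := (Real.sqrt_pos.2 hpos).ne'
  refine (((hasDerivAt_snQuartic ρ (sn ρ u)).comp u (hasDerivAt_sn hρ hu)).sqrt
    hpos.ne').congr_deriv ?_
  simp only [Function.comp_apply]
  field_simp

lemma contDiffOn_sn (n : ℕ) : ContDiffOn ℝ n (sn ρ) (snDomain ρ) := by
  induction n with
  | zero => exact contDiffOn_zero.2 fun u hu => (continuousAt_sn hρ hu).continuousWithinAt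
  | succ n ih =>
    push_cast
    rw [contDiffOn_succ_iff_deriv_of_isOpen (isOpen_snDomain hρ)]
    refine ⟨fun u hu => (hasDerivAt_sn hρ hu).differentiableAt.differentiableWithinAt, by simp, ?_⟩
    have hsqrt : ContDiffOn ℝ n (fun v => √(snQuartic ρ (sn ρ v))) (snDomain ρ) := by
      refine ContDiffOn.sqrt ?_ fun u hu => (snQuartic_pos hρ (sn_mem hu)).ne'
      unfold snQuartic
      fun_prop
    exact hsqrt.congr fun u hu => (hasDerivAt_sn hρ hu).deriv

lemma hasDerivAt_ofReal_sn_sq (hu : u ∈ snDomain ρ) :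
    HasDerivAt (fun v : ℝ => (sn ρ v : ℂ) ^ 2) (2 * sn ρ u * √(snQuartic ρ (sn ρ u)) : ℂ) u := by
  refine ((hasDerivAt_sn hρ hu).ofReal_comp.pow 2).congr_deriv ?_
  simp

variable {F : ℂ → ℂ}

lemma contDiffAt_comp_sn_sq (hu : u ∈ snDomain ρ) (hF : AnalyticAt ℂ F ((sn ρ u : ℂ) ^ 2))
    (n : ℕ) : ContDiffAt ℝ n (fun v : ℝ => F ((sn ρ v : ℂ) ^ 2)) u := by
  have hsn : ContDiffAt ℝ n (sn ρ) u :=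
    (contDiffOn_sn hρ n).contDiffAt ((isOpen_snDomain hρ).mem_nhds hu)
  have hsq : ContDiffAt ℝ n (fun v : ℝ => (sn ρ v : ℂ) ^ 2) u :=
    (Complex.ofRealCLM.contDiff.contDiffAt.comp u hsn).pow 2
  exact (hF.contDiffAt.restrict_scalars ℝ).comp u hsq

lemma deriv_comp_sn_sq_eventuallyEq (hu : u ∈ snDomain ρ)
    (hF : AnalyticAt ℂ F ((sn ρ u : ℂ) ^ 2)) :
    (deriv fun v : ℝ => F ((sn ρ v : ℂ) ^ 2)) =ᶠ[𝓝 u] fun v =>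
      deriv F ((sn ρ v : ℂ) ^ 2) * (2 * sn ρ v * √(snQuartic ρ (sn ρ v)) : ℂ) := by
  filter_upwards [(isOpen_snDomain hρ).mem_nhds hu,
    (hasDerivAt_ofReal_sn_sq hρ hu).continuousAt.eventually hF.eventually_analyticAt] with v hv hFv
  exact (hFv.differentiableAt.hasDerivAt.comp v (hasDerivAt_ofReal_sn_sq hρ hv)).deriv

theorem deriv_deriv_comp_sn_sq (α h : ℝ) (hu : u ∈ snDomain ρ)
    (hF : AnalyticAt ℂ F ((sn ρ u : ℂ) ^ 2)) :
    deriv (deriv fun v : ℝ => F ((sn ρ v : ℂ) ^ 2)) u =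
      4 * lameOp ρ α h F ((sn ρ u : ℂ) ^ 2) +
        ((α * (α + 1) * ρ ^ 2 * sn ρ u ^ 2 - h : ℝ) : ℂ) * F ((sn ρ u : ℂ) ^ 2) := by
  have hroot : ((√(snQuartic ρ (sn ρ u)) : ℝ) : ℂ) ^ 2 =
      (1 - (sn ρ u : ℂ) ^ 2) * (1 - (ρ : ℂ) ^ 2 * (sn ρ u : ℂ) ^ 2) := by
    exact_mod_cast Real.sq_sqrt (snQuartic_pos hρ (sn_mem hu)).le
  have houter := hF.deriv.differentiableAt.hasDerivAt.comp u (hasDerivAt_ofReal_sn_sq hρ hu)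
  have hinner := ((hasDerivAt_sn hρ hu).ofReal_comp.const_mul 2).mul
    (hasDerivAt_sqrt_snQuartic_sn hρ hu).ofReal_comp
  rw [(deriv_comp_sn_sq_eventuallyEq hρ hu hF).deriv_eq]
  refine (houter.mul hinner).deriv.trans ?_
  simp only [Function.comp_apply, Pi.mul_apply, lameOp]
  push_cast
  linear_combination (4 * (sn ρ u : ℂ) ^ 2 * deriv (deriv F) ((sn ρ u : ℂ) ^ 2) +
    2 * deriv F ((sn ρ u : ℂ) ^ 2)) * hroot

end Sn

theorem deriv_deriv_LFR_sn_sq {ρ α h u : ℝ}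
    (hh : ∀ m : ℕ, 2 ≤ m → h ≠ 4 * (1 + ρ ^ 2) * (m : ℝ) ^ 2) (hρ : |ρ| ≤ 1)
    (hu : u ∈ snDomain ρ) (hD : (sn ρ u : ℂ) ^ 2 ∈ domain ρ) :
    deriv (deriv fun v : ℝ => LFR ρ α h ((sn ρ v : ℂ) ^ 2)) u =
      ((α * (α + 1) * ρ ^ 2 * sn ρ u ^ 2 - h : ℝ) : ℂ) * LFR ρ α h ((sn ρ u : ℂ) ^ 2) := by
  rw [deriv_deriv_comp_sn_sq hρ α h hu (analyticOnNhd_LFR hh _ hD), lameOp_LFR hh hD, mul_zero,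
    zero_add]

end Lame

end

theorem mainTheorem3_general (ρ α h : ℝ) (hρ : ρ ≠ 0)
    (hh : ∀ m : ℕ, 2 ≤ m → h ≠ 4 * (1 + ρ ^ 2) * (m : ℝ) ^ 2) :
    (∀ ξ ∈ Lame.domain ρ, Lame.NestedConverges (Lame.rWeight ρ h) (Lame.rFactor α)
        (Lame.eta ρ ξ) (Lame.zvar ρ ξ)) ∧
    AnalyticOnNhd ℂ (Lame.LFR ρ α h) (Lame.domain ρ) ∧
    Lame.LFR ρ α h 0 = 1 ∧
    (∀ ξ ∈ Lame.domain ρ, ξ ≠ 0 → Lame.LameEqAt ρ α h (Lame.LFR ρ α h) ξ) ∧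
    (∀ y : ℂ → ℂ, AnalyticAt ℂ y 0 → y 0 = 1 →
      (∀ᶠ ξ in nhdsWithin (0 : ℂ) {0}ᶜ, Lame.LameEqAt ρ α h y ξ) →
      y =ᶠ[nhds 0] Lame.LFR ρ α h) ∧
    (|ρ| ≤ 1 → ∀ u ∈ Lame.snDomain ρ, ((Lame.sn ρ u : ℂ)) ^ 2 ∈ Lame.domain ρ →
      ContDiffAt ℝ 2 (fun v : ℝ => Lame.LFR ρ α h ((Lame.sn ρ v : ℂ) ^ 2)) u ∧
      deriv (deriv fun v : ℝ => Lame.LFR ρ α h ((Lame.sn ρ v : ℂ) ^ 2)) u =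
        ((α * (α + 1) * ρ ^ 2 * Lame.sn ρ u ^ 2 - h : ℝ) : ℂ)
          * Lame.LFR ρ α h ((Lame.sn ρ u : ℂ) ^ 2)) ∧
    ((∀ m : ℕ, 1 ≤ m → α ≠ 2 * (m : ℝ) ∧ α ≠ -(2 * (m : ℝ) + 1)) →
      ∀ ξ ∈ Lame.domain ρ,
        Lame.NestedConverges (Lame.tWeight α) (Lame.tFactor ρ h)
          (Lame.zvar ρ ξ) (Lame.eta ρ ξ) ∧
        Lame.LFR ρ α h ξ = Lame.LF ρ α h ξ) :=
  ⟨fun _ hξ => (Lame.nestedConverges_rWeight hh hξ).1,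
    Lame.analyticOnNhd_LFR hh,
    Lame.LFR_zero hh,
    fun _ hξ hξ₀ => Lame.lameEqAt_LFR hh hρ hξ hξ₀,
    fun _ hy hy₀ heq => Lame.eventuallyEq_LFR hh hρ hy hy₀ heq,
    fun hρ₁ _ hu hD => ⟨Lame.contDiffAt_comp_sn_sq hρ₁ hu (Lame.analyticOnNhd_LFR hh _ hD) 2,
      Lame.deriv_deriv_LFR_sn_sq hh hρ₁ hu hD⟩,
    fun hα _ hξ => ⟨(Lame.nestedConverges_tWeight hα hξ).1, Lame.LFR_eq_LF hh hα hξ⟩⟩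

theorem mainTheorem3 (ρ α h : ℝ) (hρ0 : 0 < ρ) (hρ1 : ρ < 1)
    (hh : ∀ m : ℕ, 2 ≤ m → h ≠ 4 * (1 + ρ ^ 2) * (m : ℝ) ^ 2) :
    -- every series in the R3TRF expansion converges
    (∀ ξ ∈ Lame.domain ρ, Lame.NestedConverges (Lame.rWeight ρ h) (Lame.rFactor α)
        (Lame.eta ρ ξ) (Lame.zvar ρ ξ)) ∧
    -- its sum is the Frobenius solution with exponent `0` and `c₀ = 1`
    AnalyticOnNhd ℂ (Lame.LFR ρ α h) (Lame.domain ρ) ∧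
    Lame.LFR ρ α h 0 = 1 ∧
    (∀ ξ ∈ Lame.domain ρ, ξ ≠ 0 → Lame.LameEqAt ρ α h (Lame.LFR ρ α h) ξ) ∧
    (∀ y : ℂ → ℂ, AnalyticAt ℂ y 0 → y 0 = 1 →
      (∀ᶠ ξ in nhdsWithin (0 : ℂ) {0}ᶜ, Lame.LameEqAt ρ α h y ξ) →
      y =ᶠ[nhds 0] Lame.LFR ρ α h) ∧
    -- with `ξ = sn²(u, ρ)` it solves Lamé's equation in Weierstrass's form
    (∀ u ∈ Lame.snDomain ρ, ((Lame.sn ρ u : ℂ)) ^ 2 ∈ Lame.domain ρ →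
      ContDiffAt ℝ 2 (fun v : ℝ => Lame.LFR ρ α h ((Lame.sn ρ v : ℂ) ^ 2)) u ∧
      deriv (deriv fun v : ℝ => Lame.LFR ρ α h ((Lame.sn ρ v : ℂ) ^ 2)) u =
        ((α * (α + 1) * ρ ^ 2 * Lame.sn ρ u ^ 2 - h : ℝ) : ℂ)
          * Lame.LFR ρ α h ((Lame.sn ρ u : ℂ) ^ 2)) ∧
    -- it is equivalent to the 3TRF series, whenever the latter is an infinite series
    ((∀ m : ℕ, 1 ≤ m → α ≠ 2 * (m : ℝ) ∧ α ≠ -(2 * (m : ℝ) + 1)) →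
      ∀ ξ ∈ Lame.domain ρ,
        Lame.NestedConverges (Lame.tWeight α) (Lame.tFactor ρ h)
          (Lame.zvar ρ ξ) (Lame.eta ρ ξ) ∧
        Lame.LFR ρ α h ξ = Lame.LF ρ α h ξ) := by
  obtain ⟨hconv, hana, hzero, heq, huniq, hsn, hLF⟩ := mainTheorem3_general ρ α h hρ0.ne' hh
  exact ⟨hconv, hana, hzero, heq, huniq, hsn (abs_le.2 ⟨by linarith, hρ1.le⟩), hLF⟩
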